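/- Consider the Poincaré patch of AdS$_3$ with metric $(-dT^2+dZ^2+dX^2)/Z^2$, $Z>0$; fix a bulk point $(T',X',Z')$, $Z'>0$, and let $(T,X)\in\mathbb R^2$ denote a boundary point. Put $\Delta T=T'-T$, $\Delta X=X'-X$ and $k^2=-\omega^2+k_X^2$. For real $\mu>-1$ let $$m_\mu(\omega,k_X)=2^{\mu}\,\Gamma(1+\mu)\,(\omega^2-k_X^2)^{-\mu/2}\,Z'J_{\mu}\!\big(\sqrt{-k^2}\,Z'\big),$$ where $J_\mu$ is the Bessel function of the first kind; for spacelike momenta $\omega^2<k_X^2$ the expression is understood by analytic continuation in $k^2$ (equivalently, with principal branches). For $\nu\ge 0$ the Dirichlet kernel is the Fourier integral with symbol $m=m_\nu$, and for $0<\nu<1$ and $\gamma\in\mathbb R$ the Robin kernel is the one with symbol $m=\cos\gamma\; m_\nu+\sin\gamma\; m_{-\nu}$: $$K(T,X|T',X',Z')=\int_{\mathbb R^2}\frac{d\omega\,dk_X}{(2\pi)^2}\;e^{-i\omega\Delta T+ik_X\Delta X}\,m(\omega,k_X).$$ Since $m$ grows exponentially in spacelike directions, $K$ is a generalized function: for a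 Schwartz function $f$ on $\mathbb R^2$ put $\tilde f(\omega,k_X)=\int e^{-i\omega\Delta T+ik_X\Delta X}f(T,X)\,dT\,dX$ and $$K[f]=\frac1{(2\pi)^2}\int_{\mathbb R}dk_X\int_{\mathbb R}d\omega\; m(\omega,k_X)\,\tilde f(\omega,k_X).$$ We say that $f$ is in the domain of $K$ if the $\omega$-integral converges absolutely for every $k_X$ and its value is absolutely integrable in $k_X$. We say that $K$ has the value $c$ at the point $(T,X)$ if for every $k_X$ the limit $g(k_X)=\lim_{R\to\infty}\int_{-R}^{R}e^{-i\omega\Delta T+ik_X\Delta X}m(\omega,k_X)\,d\omega$ exists, $g$ is integrable, and $(2\pi)^{-2}\int g\,dk_X=c$. Then, for the Dirichlet kernel ($\nu\ge0$) and for the Robin kernel ($0<\nu<1$): 1. (Definedness.) If $f$ is Schwartz and, for some $B\in\mathbb{R}$, $\tilde f(\omega,k_X)=0$ whenever $k_X^2-\omega^2>B$ (for instance if $f$ has only causal momenta, or bounded $k_X$), then $f$ is in the domain of $K$ and $m\tilde f$ is absolutely integrable on $\mathbb R^2$. 2. (Reality.) $K[f]\in\mathbb R$ for every real-valued $f$ in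 the domain, and every value of $K$ at a point, where it exists, is real. 3. (Spacelike support.) There is an open set $U\subseteq\mathbb R^2$ that contains all boundary points that are timelike separated from the bulk point, $\Delta X^2+Z'^2-\Delta T^2<0$, and all lightlike separated ones, $\Delta X^2+Z'^2-\Delta T^2=0$, with $\Delta X\ne0$, such that $K$ vanishes on $U$: every Schwartz function $f$ whose support is contained in $U$ is in the domain of $K$ and satisfies $K[f]=0$. 4. (Pointwise vanishing.) For the Dirichlet kernel ($\nu\ge 0$), and for the Robin kernel when $\nu<1/2$, $K$ has the value $0$ at every boundary point that is timelike separated, or lightlike separated with $\Delta X\ne 0$, from the bulk point. -/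

import Mathlib

open scoped SchwartzMap
open MeasureTheory Filter Topology

noncomputable section

/-- The Bessel function of the first kind `J_μ(z)`, real order `μ`, principal branch in `z`.
(`1 / Γ` vanishes at the poles of `Γ`, in agreement with Lean's `x / 0 = 0`.) -/
def besselJ (μ : ℝ) (z : ℂ) : ℂ :=
  (z / 2) ^ (μ : ℂ) *
    ∑' n : ℕ, ((-1 : ℂ) ^ n / ((n.factorial : ℂ) * Complex.Gamma ((n : ℂ) + (μ : ℂ) + 1))) *
      (z / 2) ^ (2 * n)

/-- `-k² = ω² - k_X²`, as a complex number. -/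
def negMomentumSq (ω k : ℝ) : ℂ := (ω : ℂ) ^ 2 - (k : ℂ) ^ 2

/-- The radial mode `Z J_μ(√(-k²) Z)` of the Klein–Gordon equation on the Poincaré patch of AdS₃,
at momentum `(ω, k_X)`. -/
def radialMode (μ Z ω k : ℝ) : ℂ :=
  (Z : ℂ) * besselJ μ (negMomentumSq ω k ^ (1 / 2 : ℂ) * (Z : ℂ))

/-- The momentum-space kernel `2^μ Γ(1 + μ) (ω² - k_X²)^(-μ/2) Z J_μ(√(-k²) Z)`, for all real
momenta, spacelike ones included. For `ω² < k_X²` the principal branches of the two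
powers are used; off the null set `ω² = k_X²` this is the entire function of `ω² - k_X²`
that continues the expression from timelike momenta. -/
def modeSymbol (μ Z ω k : ℝ) : ℂ :=
  (2 : ℂ) ^ (μ : ℂ) * Complex.Gamma (1 + (μ : ℂ)) *
    negMomentumSq ω k ^ (-(μ : ℂ) / 2) * radialMode μ Z ω k

/-- Momentum-space Dirichlet kernel, `Δ₊ = 1 + ν`. -/
def dirichletSymbol (ν Z ω k : ℝ) : ℂ := modeSymbol ν Z ω k

/-- Momentum-space Neumann kernel, obtained by `ν ↦ -ν`, so `Δ₋ = 1 - ν`. -/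
def neumannSymbol (ν Z ω k : ℝ) : ℂ := modeSymbol (-ν) Z ω k

/-- Momentum-space Robin kernel with boundary-condition parameter `γ`. -/
def robinSymbol (ν γ Z ω k : ℝ) : ℂ :=
  (Real.cos γ : ℂ) * dirichletSymbol ν Z ω k + (Real.sin γ : ℂ) * neumannSymbol ν Z ω k

/-- The plane wave `exp(-iω(T' - T) + i k_X (X' - X))`; the boundary point is `p = (T, X)`. -/
def planeWave (T' X' ω k : ℝ) (p : ℝ × ℝ) : ℂ :=
  Complex.exp (-Complex.I * ω * (T' - p.1) + Complex.I * k * (X' - p.2))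

/-- The test function `f` integrated against the plane wave of momentum `(ω, k_X)`. -/
def waveTransform (T' X' : ℝ) (f : 𝓢(ℝ × ℝ, ℂ)) (ω k : ℝ) : ℂ :=
  ∫ p : ℝ × ℝ, planeWave T' X' ω k p * f p

/-- The kernel with symbol `m` can be applied to the test function `f`: the momentum integral,
with the `ω`-integral done first, converges absolutely at each of its two steps. -/
def InKernelDomain (m : ℝ → ℝ → ℂ) (T' X' : ℝ) (f : 𝓢(ℝ × ℝ, ℂ)) : Prop :=
  (∀ k : ℝ, Integrable (fun ω : ℝ => m ω k * waveTransform T' X' f ω k)) ∧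
    Integrable (fun k : ℝ => ∫ ω : ℝ, m ω k * waveTransform T' X' f ω k)

/-- `∫ K(T,X|T',X',Z') f(T,X) dT dX`, for the generalized function
`K = ∫ dω dk_X / (2π)² exp(-iω(T' - T) + i k_X (X' - X)) m(ω, k_X)`. -/
def kernelPairing (m : ℝ → ℝ → ℂ) (T' X' : ℝ) (f : 𝓢(ℝ × ℝ, ℂ)) : ℂ :=
  (1 / (2 * Real.pi) ^ 2 : ℝ) * ∫ k : ℝ, ∫ ω : ℝ, m ω k * waveTransform T' X' f ω k

/-- The value at the boundary point `p` of the Fourier integral `K` exists and equals `c`: the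
improper `ω`-integral converges for every `k_X`, and the result is integrable in `k_X`. -/
def HasKernelValue (m : ℝ → ℝ → ℂ) (T' X' : ℝ) (p : ℝ × ℝ) (c : ℂ) : Prop :=
  ∃ g : ℝ → ℂ,
    (∀ k : ℝ, Tendsto (fun R : ℝ => ∫ ω in (-R)..R, planeWave T' X' ω k p * m ω k)
      atTop (𝓝 (g k))) ∧
    Integrable g ∧ (1 / (2 * Real.pi) ^ 2 : ℝ) * ∫ k : ℝ, g k = c

/-- `K` is defined, by an absolutely convergent integral over all momenta, on all Schwartz
functions whose spacelike momenta are bounded in invariant size. These include the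
functions with only causal momenta and those with bounded `k_X`. -/
def IsDefinedKernel (m : ℝ → ℝ → ℂ) (T' X' : ℝ) : Prop :=
  ∀ f : 𝓢(ℝ × ℝ, ℂ), ∀ B : ℝ,
    (∀ ω k : ℝ, B < k ^ 2 - ω ^ 2 → waveTransform T' X' f ω k = 0) →
      InKernelDomain m T' X' f ∧
        Integrable (fun q : ℝ × ℝ => m q.1 q.2 * waveTransform T' X' f q.1 q.2)

/-- `K` is real: it takes real values on real test functions, and its point values, where they
exist, are real. -/
def IsRealKernel (m : ℝ → ℝ → ℂ) (T' X' : ℝ) : Prop :=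
  (∀ f : 𝓢(ℝ × ℝ, ℂ), InKernelDomain m T' X' f → (∀ p, (f p).im = 0) →
    (kernelPairing m T' X' f).im = 0) ∧
  ∀ (p : ℝ × ℝ) (c : ℂ), HasKernelValue m T' X' p c → c.im = 0

/-- `K` vanishes on the set `U` of boundary points, as a generalized function. -/
def KernelVanishesOn (m : ℝ → ℝ → ℂ) (T' X' : ℝ) (U : Set (ℝ × ℝ)) : Prop :=
  ∀ f : 𝓢(ℝ × ℝ, ℂ), tsupport (f : ℝ × ℝ → ℂ) ⊆ U →
    InKernelDomain m T' X' f ∧ kernelPairing m T' X' f = 0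

/-- `lim_{Z → 0} 2 Z Z' σ = ΔX² + Z'² - ΔT²`, for the invariant distance `σ` of the bulk point
`(T', X', Z')` and the point `(T, X, Z)` that tends to the boundary point `p = (T, X)`. -/
def boundaryInterval (T' X' Z' : ℝ) (p : ℝ × ℝ) : ℝ :=
  (X' - p.2) ^ 2 + Z' ^ 2 - (T' - p.1) ^ 2

/-- Boundary points timelike separated from the bulk point. -/
def timelikeRegion (T' X' Z' : ℝ) : Set (ℝ × ℝ) := {p | boundaryInterval T' X' Z' p < 0}

/-- Boundary points lightlike separated from the bulk point, other than the two
with `ΔX = 0`. -/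
def lightlikeRegion (T' X' Z' : ℝ) : Set (ℝ × ℝ) :=
  {p | boundaryInterval T' X' Z' p = 0 ∧ p.2 ≠ X'}

/-- `K` has spacelike support: it vanishes on an open set that contains all boundary points that are
timelike, or lightlike with `ΔX ≠ 0`, from the bulk point. -/
def HasSpacelikeSupport (m : ℝ → ℝ → ℂ) (T' X' Z' : ℝ) : Prop :=
  ∃ U : Set (ℝ × ℝ), IsOpen U ∧ timelikeRegion T' X' Z' ∪ lightlikeRegion T' X' Z' ⊆ U ∧
    KernelVanishesOn m T' X' U

/-- At each of these boundary points the Fourier integral converges, with value `0`. -/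
def VanishesPointwise (m : ℝ → ℝ → ℂ) (T' X' Z' : ℝ) : Prop :=
  ∀ p ∈ timelikeRegion T' X' Z' ∪ lightlikeRegion T' X' Z', HasKernelValue m T' X' p 0

end

/-! For fixed `k` the symbol, up to a constant, is the entire function `besselClifford a` at `Z² (k²
- ω²) / 4` with `a = 1 + μ`, off a null set of `ω`. As a function of `ω` it has exponential type `Z`
for every `k`; all exponential growth sits in the `k`-dependence. Its Fourier transform in `ω` thus
lives on `[-Z, Z]`, and the kernel vanishes where `|T' - T| > Z`. A timelike point satisfies this,
and so does a lightlike one with `ΔX ≠ 0`.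

The quantitative form is a Sonine-type cosine integral (`besselClifford_eq_integral_cos`), valid for
`a > 1/2`, whose density is integrable. For `0 < a ≤ 1/2`, `besselClifford_recurrence` writes the
symbol as `p + ω² q` with `p`, `q` of Paley–Wiener type. The factor `ω²` is harmless against test
functions, being a second derivative on the Fourier side, but is not covered by the pointwise
argument; hence `ν < 1/2` there.

The `ω`-integral is done first and is exactly zero for each `k`, so growth in `k` never matters for
the support statement. Definedness follows from polynomial growth where `k² - ω²` is bounded above,
and reality from the symbol being real and even. -/

noncomputable section

/-! ### The Bessel–Clifford series -/

/-- The Bessel–Clifford function `∑ xⁿ / (n! Γ(a + n))`. -/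
def besselClifford (a x : ℝ) : ℝ := ∑' n : ℕ, x ^ n / (n.factorial * Real.Gamma (a + n))

theorem exists_pos_le_Gamma_add_nat {a : ℝ} (ha : 0 < a) :
    ∃ c : ℝ, 0 < c ∧ ∀ n : ℕ, c ≤ Real.Gamma (a + n) := by
  have hp : ∀ n : ℕ, 0 < Real.Gamma (a + n) := fun n => Real.Gamma_pos_of_pos (by positivity)
  -- The first factor `a` in `Γ(a + 1) = a Γ(a)` may be below `1`; all later factors `a + n` exceed
  -- `1`, so the values increase from `Γ(a + 1)` on.
  refine ⟨min (Real.Gamma a) (Real.Gamma (a + 1)), lt_min (by simpa using hp 0)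
    (by simpa using hp 1), fun n => ?_⟩
  rcases n with _ | n
  · simp
  · refine (min_le_right _ _).trans ?_
    induction n with
    | zero => simp
    | succ n ih =>
      refine ih.trans ?_
      have h : a + ((n + 1 + 1 : ℕ) : ℝ) = (a + (n + 1 : ℕ)) + 1 := by push_cast; ring
      rw [h, Real.Gamma_add_one (by positivity)]
      have := hp (n + 1)
      push_cast at this ⊢
      nlinarith [Nat.cast_nonneg (α := ℝ) n]

theorem summable_besselClifford_norm {a : ℝ} (ha : 0 < a) (x : ℝ) :
    Summable fun n : ℕ => ‖x ^ n / (n.factorial * Real.Gamma (a + n))‖ := by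
  obtain ⟨c, hc, h⟩ := exists_pos_le_Gamma_add_nat ha
  refine Summable.of_nonneg_of_le (fun n => norm_nonneg _) (fun n => ?_)
    ((Real.summable_pow_div_factorial |x|).mul_left c⁻¹)
  have h1 := h n
  rw [norm_div, norm_pow, Real.norm_eq_abs, Real.norm_of_nonneg (by positivity), inv_mul_eq_div,
    div_div]
  gcongr

theorem hasSum_besselClifford {a : ℝ} (ha : 0 < a) (x : ℝ) :
    HasSum (fun n : ℕ => x ^ n / (n.factorial * Real.Gamma (a + n))) (besselClifford a x) :=
  (summable_besselClifford_norm ha x).of_norm.hasSum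

theorem continuous_besselClifford {a : ℝ} (ha : 0 < a) : Continuous (besselClifford a) := by
  rw [continuous_iff_continuousAt]
  intro x
  have hc : ContinuousOn (besselClifford a) (Metric.ball 0 (|x| + 1)) := by
    refine continuousOn_tsum (fun n => by fun_prop)
      (summable_besselClifford_norm ha (|x| + 1)) fun n y hy => ?_
    rw [mem_ball_zero_iff, Real.norm_eq_abs] at hy
    simp only [norm_div, norm_pow, Real.norm_eq_abs]
    have : |y| ≤ |(|x| + 1)| := hy.le.trans (le_abs_self _)
    gcongr
  exact hc.continuousAt (Metric.isOpen_ball.mem_nhds (by simp))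

/-- Coefficientwise this is `Γ(s + 1) = s Γ(s)` with `s = a + n`. It trades a small order for orders
above `1/2`, where the cosine integral is available, at the cost of a factor `x`. -/
theorem besselClifford_recurrence {a : ℝ} (ha : 0 < a) (x : ℝ) :
    besselClifford a x = a * besselClifford (a + 1) x + x * besselClifford (a + 2) x := by
  have h0 := hasSum_besselClifford ha x
  have h1 := (hasSum_besselClifford (a := a + 1) (by positivity) x).mul_left a
  have h2 := (hasSum_besselClifford (a := a + 2) (by positivity) x).mul_left x
  have hG : ∀ n : ℕ, 0 < Real.Gamma (a + n) := fun n => Real.Gamma_pos_of_pos (by positivity)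
  have hs : ∀ n : ℕ, Real.Gamma (a + n + 1) = (a + n) * Real.Gamma (a + n) := fun n =>
    Real.Gamma_add_one (by positivity)
  rw [← hasSum_nat_add_iff' 1] at h0 h1
  have h3 := h1.add h2
  have : ∀ n : ℕ, a * (x ^ (n + 1) / ((n + 1).factorial * Real.Gamma (a + 1 + (n + 1 : ℕ)))) +
      x * (x ^ n / (n.factorial * Real.Gamma (a + 2 + n))) =
      x ^ (n + 1) / ((n + 1).factorial * Real.Gamma (a + (n + 1 : ℕ))) := by
    intro n
    have e1 : a + 1 + ((n + 1 : ℕ) : ℝ) = a + (n + 1 : ℕ) + 1 := by ring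
    have e2 : a + 2 + (n : ℝ) = a + (n + 1 : ℕ) + 1 := by push_cast; ring
    rw [e1, e2, hs, Nat.factorial_succ]
    have h4 := (hG (n + 1)).ne'
    have h5 : a + ((n + 1 : ℕ) : ℝ) ≠ 0 := by positivity
    have h6 := n.factorial_pos.ne'
    push_cast at h4 h5 ⊢
    field_simp
    ring
  simp only [this] at h3
  have h4 := h0.unique h3
  have h5 : Real.Gamma (a + 1) = a * Real.Gamma a := Real.Gamma_add_one ha.ne'
  have h6 : Real.Gamma a ≠ 0 := (Real.Gamma_pos_of_pos ha).ne'
  simp only [Finset.range_one, Finset.sum_singleton, pow_zero, Nat.factorial_zero, Nat.cast_one,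
    one_mul, Nat.cast_zero, add_zero, h5] at h4
  have h7 : a * (1 / (a * Real.Gamma a)) = 1 / Real.Gamma a := by field_simp
  rw [h7] at h4
  linarith

/-! ### The cosine integral for shifted arguments -/

/-- Moments of the density `(1 - t²)^(b - 1)` on the unit interval. -/
theorem integrableOn_and_integral_pow_mul_rpow {b : ℝ} (hb : 0 < b) (n : ℕ) :
    IntegrableOn (fun t : ℝ => t ^ (2 * n) * (1 - t ^ 2) ^ (b - 1)) (Set.Ioo 0 1) ∧
    2 * ∫ t in Set.Ioo (0 : ℝ) 1, t ^ (2 * n) * (1 - t ^ 2) ^ (b - 1) =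
      Real.Gamma (n + 1 / 2) * Real.Gamma b / Real.Gamma (n + 1 / 2 + b) := by
  set α : ℝ := n + 1 / 2 with hα
  have hα0 : 0 < α := by positivity
  -- The substitution `x = t²` reduces the moment to the beta integral `B(n + 1/2, b)`, which is
  -- first brought from complex to real form.
  have himg : (fun t : ℝ => t ^ 2) '' Set.Ioo 0 1 = Set.Ioo 0 1 := by
    ext y
    constructor
    · rintro ⟨t, ⟨h0, h1⟩, rfl⟩
      exact ⟨by positivity, by nlinarith⟩
    · rintro ⟨h0, h1⟩
      refine ⟨√y, ⟨Real.sqrt_pos.2 h0, ?_⟩, Real.sq_sqrt h0.le⟩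
      rw [Real.sqrt_lt' one_pos]; simpa using h1
  have hder : ∀ t ∈ Set.Ioo (0 : ℝ) 1, HasDerivWithinAt (fun t : ℝ => t ^ 2) (2 * t)
      (Set.Ioo 0 1) t := fun t _ => by
    simpa using (hasDerivAt_pow 2 t).hasDerivWithinAt
  have hinj : Set.InjOn (fun t : ℝ => t ^ 2) (Set.Ioo 0 1) := fun s hs t ht h => by
    have := (sq_eq_sq₀ hs.1.le ht.1.le).1 h
    exact this
  have hcv := Complex.betaIntegral_convergent (u := (α : ℂ)) (v := (b : ℂ)) (by simpa) (by simpa)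
  rw [intervalIntegrable_iff_integrableOn_Ioo_of_le zero_le_one] at hcv
  have hreal : Set.EqOn (fun x : ℝ => ((x : ℂ) ^ ((α : ℂ) - 1) * (1 - (x : ℂ)) ^ ((b : ℂ) - 1)))
      (fun x : ℝ => ((x ^ (α - 1) * (1 - x) ^ (b - 1) : ℝ) : ℂ)) (Set.Ioo 0 1) := by
    intro x hx
    have h1 : (0 : ℝ) ≤ 1 - x := by linarith [hx.2]
    simp only
    push_cast [Complex.ofReal_cpow hx.1.le, Complex.ofReal_cpow h1]
    rfl
  have hint : IntegrableOn (fun x : ℝ => x ^ (α - 1) * (1 - x) ^ (b - 1)) (Set.Ioo 0 1) := by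
    have := (hcv.congr_fun hreal measurableSet_Ioo).re
    simpa [IntegrableOn] using this
  have hval : ∫ x in Set.Ioo (0 : ℝ) 1, x ^ (α - 1) * (1 - x) ^ (b - 1) =
      Real.Gamma α * Real.Gamma b / Real.Gamma (α + b) := by
    have h := Complex.betaIntegral_eq_Gamma_mul_div (α : ℂ) (b : ℂ) (by simpa) (by simpa)
    rw [Complex.betaIntegral, intervalIntegral.integral_of_le zero_le_one,
      integral_Ioc_eq_integral_Ioo, setIntegral_congr_fun measurableSet_Ioo hreal,
      integral_complex_ofReal, ← Complex.ofReal_add, Complex.Gamma_ofReal, Complex.Gamma_ofReal,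
      Complex.Gamma_ofReal] at h
    exact_mod_cast h
  have hsub : Set.EqOn
      (fun t : ℝ => |2 * t| • ((t ^ 2) ^ (α - 1) * (1 - t ^ 2) ^ (b - 1)))
      (fun t : ℝ => 2 * (t ^ (2 * n) * (1 - t ^ 2) ^ (b - 1))) (Set.Ioo 0 1) := by
    intro t ht
    have ht0 := ht.1
    have h1 : (t ^ 2) ^ (α - 1) * t = t ^ (2 * n) := by
      rw [← Real.rpow_natCast t 2, ← Real.rpow_mul ht0.le, ← Real.rpow_add_one ht0.ne',
        ← Real.rpow_natCast t (2 * n)]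
      congr 1
      push_cast [hα]
      ring
    simp only [smul_eq_mul]
    rw [abs_of_pos (by positivity), ← h1]
    ring
  constructor
  · have h := (integrableOn_image_iff_integrableOn_abs_deriv_smul measurableSet_Ioo hder hinj
      (fun x => x ^ (α - 1) * (1 - x) ^ (b - 1))).1 (by rwa [himg])
    have h2 := h.congr_fun hsub measurableSet_Ioo
    have h3 : IntegrableOn (fun t : ℝ => (1 / 2 : ℝ) *
      (2 * (t ^ (2 * n) * (1 - t ^ 2) ^ (b - 1)))) (Set.Ioo 0 1) := Integrable.const_mul h2 (1 / 2)
    refine h3.congr_fun (fun t _ => ?_) measurableSet_Ioo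
    simp only
    ring
  · have h := integral_image_eq_integral_abs_deriv_smul measurableSet_Ioo hder hinj
      (fun x => x ^ (α - 1) * (1 - x) ^ (b - 1))
    rw [himg, hval, setIntegral_congr_fun measurableSet_Ioo hsub, integral_const_mul] at h
    exact h.symm

/-- The duplication formula in the form that cancels the `(2n)!` of the cosine series against the
`Γ(n + 1/2)` of the moments. -/
theorem factorial_two_mul_mul_sqrt_pi (n : ℕ) :
    ((2 * n).factorial : ℝ) * √Real.pi = 4 ^ n * n.factorial * Real.Gamma (n + 1 / 2) := by
  induction n with
  | zero => rw [Nat.cast_zero, zero_add, Real.Gamma_one_half_eq]; simp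
  | succ n ih =>
    have h : ((n + 1 : ℕ) : ℝ) + 1 / 2 = (n + 1 / 2) + 1 := by push_cast; ring
    rw [h, Real.Gamma_add_one (by positivity), show 2 * (n + 1) = 2 * n + 1 + 1 by ring,
      Nat.factorial_succ, Nat.factorial_succ, Nat.factorial_succ n, pow_succ]
    push_cast
    linear_combination (2 * (n : ℝ) + 1 + 1) * (2 * n + 1) * ih

theorem summable_double_besselClifford {a : ℝ} (ha : 0 < a) (x y : ℝ) :
    Summable fun p : ℕ × ℕ => ‖x ^ p.1 * y ^ p.2 /
      (p.1.factorial * p.2.factorial * Real.Gamma (a + (p.1 + p.2 : ℕ)))‖ := by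
  obtain ⟨c, hc, h⟩ := exists_pos_le_Gamma_add_nat ha
  have hs := ((Real.summable_pow_div_factorial |x|).mul_of_nonneg
    (Real.summable_pow_div_factorial |y|) (fun n => by positivity) (fun n => by positivity)).mul_left
    c⁻¹
  refine Summable.of_nonneg_of_le (fun _ => norm_nonneg _) (fun p => ?_) hs
  have h1 := h (p.1 + p.2)
  have e : c⁻¹ * (|x| ^ p.1 / p.1.factorial * (|y| ^ p.2 / p.2.factorial)) =
      |x| ^ p.1 * |y| ^ p.2 / (p.1.factorial * p.2.factorial * c) := by
    field_simp
  rw [e, norm_div, norm_mul, norm_pow, norm_pow, Real.norm_eq_abs, Real.norm_eq_abs,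
    Real.norm_of_nonneg (by positivity)]
  gcongr

/-- The Gamma factor depends only on `p.1 + p.2`, so summing along antidiagonals leaves the binomial
theorem. -/
theorem tsum_double_besselClifford {a : ℝ} (ha : 0 < a) (x y : ℝ) :
    ∑' p : ℕ × ℕ, x ^ p.1 * y ^ p.2 /
      (p.1.factorial * p.2.factorial * Real.Gamma (a + (p.1 + p.2 : ℕ))) =
    besselClifford a (x + y) := by
  have hs := (summable_double_besselClifford ha x y).of_norm
  rw [← Finset.HasAntidiagonal.sigmaAntidiagonalEquivProd.tsum_eq]
  refine ((Finset.HasAntidiagonal.sigmaAntidiagonalEquivProd.summable_iff.2 hs).tsum_sigma'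
    (fun n => (hasSum_fintype _).summable)).trans ?_
  refine tsum_congr fun n => ?_
  rw [tsum_fintype]
  refine (Finset.sum_finset_coe (fun p : ℕ × ℕ => x ^ p.1 * y ^ p.2 /
      (p.1.factorial * p.2.factorial * Real.Gamma (a + (p.1 + p.2 : ℕ))))
      (Finset.HasAntidiagonal.antidiagonal n : Finset (ℕ × ℕ))).trans ?_
  rw [(Commute.all x y).add_pow', Finset.sum_div]
  refine Finset.sum_congr rfl fun p hp => ?_
  have hn := Finset.HasAntidiagonal.mem_antidiagonal.1 hp
  subst hn
  have hG : Real.Gamma (a + (p.1 + p.2 : ℕ)) ≠ 0 := (Real.Gamma_pos_of_pos (by positivity)).ne'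
  have h1 := Nat.choose_mul_factorial_mul_factorial (Nat.le_add_right p.1 p.2)
  rw [Nat.add_sub_cancel_left] at h1
  have h2 : ((p.1 + p.2).choose p.1 : ℝ) * p.1.factorial * p.2.factorial =
    (p.1 + p.2).factorial := by exact_mod_cast h1
  rw [nsmul_eq_mul, ← h2]
  have h3 : ((p.1 + p.2).choose p.1 : ℝ) ≠ 0 := by
    exact_mod_cast (Nat.choose_pos (Nat.le_add_right _ _)).ne'
  field_simp

/-- The density whose cosine transform is a shifted Bessel–Clifford function. -/
def besselDensity (b x t : ℝ) : ℝ :=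
  2 / √Real.pi * (1 - t ^ 2) ^ (b - 1) * besselClifford b (x * (1 - t ^ 2))

theorem integrableOn_besselDensity {b : ℝ} (hb : 0 < b) (x : ℝ) :
    IntegrableOn (besselDensity b x) (Set.Ioo 0 1) := by
  have h := (integrableOn_and_integral_pow_mul_rpow hb 0).1
  simp only [mul_zero, pow_zero, one_mul] at h
  have hc : Continuous fun t : ℝ => besselClifford b (x * (1 - t ^ 2)) :=
    (continuous_besselClifford hb).comp (by fun_prop)
  obtain ⟨C, hC⟩ := (isCompact_Icc (a := (0 : ℝ)) (b := 1)).exists_bound_of_continuousOn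
    hc.continuousOn
  refine Integrable.mul_bdd (c := C) (Integrable.const_mul h (2 / √Real.pi))
    hc.aestronglyMeasurable.restrict ?_
  exact ae_restrict_of_forall_mem measurableSet_Ioo fun t ht => hC t (Set.Ioo_subset_Icc_self ht)

/-- Expand both the density and the cosine in power series and integrate termwise: the beta moments
turn the product into the double series with `y = -θ² / 4`. At `x = 0` this is Poisson's integral;
the shift `x` will absorb `k`. -/
theorem besselClifford_eq_integral_cos {b : ℝ} (hb : 0 < b) (x θ : ℝ) :
    besselClifford (b + 1 / 2) (x - θ ^ 2 / 4) =
      ∫ t in Set.Ioo (0 : ℝ) 1, besselDensity b x t * Real.cos (θ * t) := by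
  set G : ℕ × ℕ → ℝ → ℝ := fun p t => t ^ (2 * p.2) * (1 - t ^ 2) ^ (b + p.1 - 1) with hGdef
  set κ : ℝ → ℝ → ℕ × ℕ → ℝ := fun x y p => 2 / √Real.pi * (x ^ p.1 * y ^ p.2 /
    (p.1.factorial * Real.Gamma (b + p.1) * (2 * p.2).factorial)) with hκ
  have hG : ∀ p : ℕ × ℕ, IntegrableOn (G p) (Set.Ioo 0 1) ∧ 2 * ∫ t in Set.Ioo (0 : ℝ) 1, G p t =
      Real.Gamma (p.2 + 1 / 2) * Real.Gamma (b + p.1) /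
        Real.Gamma (b + 1 / 2 + (p.1 + p.2 : ℕ)) := fun p => by
    have := integrableOn_and_integral_pow_mul_rpow (b := b + p.1) (by positivity) p.2
    rw [show (b + 1 / 2 + (p.1 + p.2 : ℕ) : ℝ) = p.2 + 1 / 2 + (b + p.1) by push_cast; ring]
    exact this
  have hval : ∀ (x y : ℝ) (p : ℕ × ℕ), ∫ t in Set.Ioo (0 : ℝ) 1, κ x y p * G p t =
      x ^ p.1 * (y / 4) ^ p.2 /
        (p.1.factorial * p.2.factorial * Real.Gamma (b + 1 / 2 + (p.1 + p.2 : ℕ))) := by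
    intro x y p
    have h1 := (hG p).2
    have h2 := factorial_two_mul_mul_sqrt_pi p.2
    have h3 : 0 < Real.Gamma (b + p.1) := Real.Gamma_pos_of_pos (by positivity)
    have h4 : 0 < Real.Gamma (p.2 + 1 / 2) := Real.Gamma_pos_of_pos (by positivity)
    have h5 : 0 < Real.Gamma (b + 1 / 2 + (p.1 + p.2 : ℕ)) := Real.Gamma_pos_of_pos (by positivity)
    have h6 : (0 : ℝ) < √Real.pi := Real.sqrt_pos.2 Real.pi_pos
    rw [integral_const_mul]
    have h7 : ∫ t in Set.Ioo (0 : ℝ) 1, G p t = Real.Gamma (p.2 + 1 / 2) * Real.Gamma (b + p.1) /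
        Real.Gamma (b + 1 / 2 + (p.1 + p.2 : ℕ)) / 2 := by linarith
    have h8 : κ x y p = 2 * (x ^ p.1 * y ^ p.2 / (p.1.factorial * Real.Gamma (b + p.1) *
        (4 ^ p.2 * p.2.factorial * Real.Gamma (p.2 + 1 / 2)))) := by
      rw [← h2, hκ]
      field_simp
    rw [h7, h8, div_pow]
    field_simp
  -- Each `G p` is nonnegative on the interval, so the `L¹` norms of the terms are the absolute
  -- values of the double series, and termwise integration is justified by its absolute convergence.
  have hnorm : ∀ p : ℕ × ℕ, ∫ t in Set.Ioo (0 : ℝ) 1, ‖κ x (-θ ^ 2) p * G p t‖ =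
      ‖x ^ p.1 * (-θ ^ 2 / 4) ^ p.2 /
        (p.1.factorial * p.2.factorial * Real.Gamma (b + 1 / 2 + (p.1 + p.2 : ℕ)))‖ := by
    intro p
    have hpos : ∀ t ∈ Set.Ioo (0 : ℝ) 1, 0 ≤ G p t := fun t ht =>
      mul_nonneg (pow_nonneg ht.1.le _) (Real.rpow_nonneg (by nlinarith [ht.1, ht.2]) _)
    rw [← hval, integral_const_mul, norm_mul, Real.norm_of_nonneg (setIntegral_nonneg measurableSet_Ioo hpos), ← integral_const_mul]
    refine setIntegral_congr_fun measurableSet_Ioo fun t ht => ?_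
    simp only [norm_mul, Real.norm_of_nonneg (hpos t ht)]
  have hsum := hasSum_integral_of_summable_integral_norm
    (μ := volume.restrict (Set.Ioo (0 : ℝ) 1)) (F := fun p t => κ x (-θ ^ 2) p * G p t)
    (fun p => Integrable.const_mul (hG p).1 _)
    (by simpa only [hnorm] using summable_double_besselClifford (by positivity) x (-θ ^ 2 / 4))
  have h := hsum.tsum_eq
  simp only [hval] at h
  rw [tsum_double_besselClifford (by positivity)] at h
  rw [show x - θ ^ 2 / 4 = x + -θ ^ 2 / 4 by ring, h]
  refine setIntegral_congr_fun measurableSet_Ioo fun t ht => ?_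
  have ht1 : 0 < 1 - t ^ 2 := by nlinarith [ht.1, ht.2]
  have hA := summable_besselClifford_norm hb (x * (1 - t ^ 2))
  have hB : Summable fun n : ℕ => ‖(-1) ^ n * (θ * t) ^ (2 * n) / ((2 * n).factorial : ℝ)‖ :=
    (Real.hasSum_cos (θ * t)).summable.norm
  simp only [besselDensity, besselClifford]
  rw [← (Real.hasSum_cos (θ * t)).tsum_eq, mul_assoc, tsum_mul_tsum_of_summable_norm hA hB,
    ← tsum_mul_left]
  refine tsum_congr fun p => ?_
  simp only [hκ, hGdef]
  have h1 : (1 - t ^ 2) ^ (b + p.1 - 1) = (1 - t ^ 2) ^ (b - 1) * (1 - t ^ 2) ^ p.1 := by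
    rw [← Real.rpow_natCast (1 - t ^ 2) p.1, ← Real.rpow_add ht1]
    congr 1; ring
  rw [h1, mul_pow, mul_pow, neg_pow, ← pow_mul]
  ring

/-! ### Functions of Paley–Wiener type -/

/-- `s` is the Fourier transform of an integrable function supported in `[-r, r]`. -/
def IsPaleyWiener (r : ℝ) (s : ℝ → ℂ) : Prop :=
  ∃ φ : ℝ → ℂ, Integrable φ ∧ (∀ t, r ≤ |t| → φ t = 0) ∧
    ∀ ω : ℝ, s ω = ∫ t : ℝ, Complex.exp (Complex.I * ω * t) * φ t

theorem norm_exp_I_mul_mul (ω t : ℝ) : ‖Complex.exp (Complex.I * ω * t)‖ = 1 := by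
  rw [show Complex.I * ω * t = ((ω * t : ℝ) : ℂ) * Complex.I by push_cast; ring,
    Complex.norm_exp_ofReal_mul_I]

theorem integrable_exp_I_mul_mul {φ : ℝ → ℂ} (hφ : Integrable φ) (ω : ℝ) :
    Integrable fun t : ℝ => Complex.exp (Complex.I * ω * t) * φ t :=
  hφ.bdd_mul (c := 1) (by fun_prop) (ae_of_all _ fun t => (norm_exp_I_mul_mul ω t).le)

theorem integrable_exp_I_mul_mul' {φ : ℝ → ℂ} (hφ : Integrable φ) (ω : ℝ) :
    Integrable fun t : ℝ => Complex.exp (Complex.I * t * ω) * φ t := by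
  simpa only [mul_right_comm] using integrable_exp_I_mul_mul hφ ω

theorem integral_exp_I_eq_fourier (F : ℝ → ℂ) (y : ℝ) :
    ∫ ω : ℝ, Complex.exp (Complex.I * ω * y) * F ω = FourierTransform.fourier F (-y / (2 * Real.pi)) := by
  rw [Real.fourier_real_eq_integral_exp_smul]
  refine integral_congr_ae (ae_of_all _ fun ω => ?_)
  simp only [smul_eq_mul]
  congr 2
  have := Real.pi_ne_zero
  push_cast
  field_simp

namespace IsPaleyWiener

variable {r : ℝ} {s s' : ℝ → ℂ}

theorem add (hs : IsPaleyWiener r s) (hs' : IsPaleyWiener r s') :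
    IsPaleyWiener r (fun ω => s ω + s' ω) := by
  obtain ⟨φ, h1, h2, h3⟩ := hs
  obtain ⟨ψ, g1, g2, g3⟩ := hs'
  refine ⟨fun t => φ t + ψ t, h1.add g1, fun t ht => by simp [h2 t ht, g2 t ht], fun ω => ?_⟩
  simp only
  rw [h3, g3, ← integral_add (integrable_exp_I_mul_mul h1 ω) (integrable_exp_I_mul_mul g1 ω)]
  simp only [mul_add]

theorem const_mul (hs : IsPaleyWiener r s) (c : ℂ) : IsPaleyWiener r (fun ω => c * s ω) := by
  obtain ⟨φ, h1, h2, h3⟩ := hs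
  refine ⟨fun t => c * φ t, h1.const_mul c, fun t ht => by simp [h2 t ht], fun ω => ?_⟩
  simp only
  rw [h3, ← integral_const_mul]
  simp only [mul_left_comm]

/-- The witness is the even extension of `ψ`, rescaled to `[-r, r]` and halved: the two exponentials
combine to the cosine. -/
theorem of_cos (hr : 0 < r) {ψ : ℝ → ℝ} (hψ : IntegrableOn ψ (Set.Ioo 0 1)) :
    IsPaleyWiener r fun ω =>
      ((∫ t in Set.Ioo (0 : ℝ) 1, ψ t * Real.cos (r * ω * t) : ℝ) : ℂ) := by
  set Ψ : ℝ → ℂ := fun t => (((Set.Ioo (0 : ℝ) 1).indicator ψ t : ℝ) : ℂ) with hΨ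
  have hΨi : Integrable Ψ := (hψ.integrable_indicator measurableSet_Ioo).ofReal
  have hr1 : r⁻¹ ≠ 0 := (inv_pos.2 hr).ne'
  have hi1 : Integrable fun t => Ψ (r⁻¹ * t) := hΨi.comp_mul_left' hr1
  have hi2 : Integrable fun t => Ψ (-r⁻¹ * t) := hΨi.comp_mul_left' (neg_ne_zero.2 hr1)
  refine ⟨fun t => (2 * r : ℂ)⁻¹ * (Ψ (r⁻¹ * t) + Ψ (-r⁻¹ * t)), (hi1.add hi2).const_mul _,
    fun t ht => ?_, fun ω => ?_⟩
  · have h1 : 1 ≤ |r⁻¹ * t| := by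
      rw [abs_mul, abs_of_pos (inv_pos.2 hr), inv_mul_eq_div, le_div_iff₀ hr]; simpa using ht
    have h2 : ∀ u : ℝ, 1 ≤ |u| → Ψ u = 0 := fun u hu => by
      have : u ∉ Set.Ioo (0 : ℝ) 1 := fun h => by
        rw [abs_of_pos h.1] at hu; exact absurd h.2 (not_lt.2 hu)
      simp [hΨ, this]
    simp only
    rw [h2 _ h1, h2 _ (by rwa [neg_mul, abs_neg])]; simp
  · have hr' : (r : ℂ) ≠ 0 := by exact_mod_cast hr.ne'
    have e1 : ∫ t : ℝ, Complex.exp (Complex.I * ω * t) * Ψ (r⁻¹ * t) =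
        r * ∫ t : ℝ, Complex.exp (Complex.I * (r * ω : ℝ) * t) * Ψ t := by
      have h := Measure.integral_comp_mul_left
        (fun t : ℝ => Complex.exp (Complex.I * (r * ω : ℝ) * t) * Ψ t) r⁻¹
      rw [inv_inv, abs_of_pos hr, Complex.real_smul] at h
      rw [← h]
      refine integral_congr_ae (ae_of_all _ fun t => ?_)
      simp only
      congr 2
      push_cast
      field_simp
    have e2 : ∫ t : ℝ, Complex.exp (Complex.I * ω * t) * Ψ (-r⁻¹ * t) =
        r * ∫ t : ℝ, Complex.exp (Complex.I * (-(r * ω) : ℝ) * t) * Ψ t := by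
      have h := Measure.integral_comp_mul_left
        (fun t : ℝ => Complex.exp (Complex.I * (-(r * ω) : ℝ) * t) * Ψ t) (-r⁻¹)
      rw [inv_neg, inv_inv, abs_neg, abs_of_pos hr, Complex.real_smul] at h
      rw [← h]
      refine integral_congr_ae (ae_of_all _ fun t => ?_)
      simp only
      congr 2
      push_cast
      field_simp
    have e3 : ∀ t : ℝ, Complex.exp (Complex.I * ω * t) *
        ((2 * r : ℂ)⁻¹ * (Ψ (r⁻¹ * t) + Ψ (-r⁻¹ * t))) =
        (2 * r : ℂ)⁻¹ * (Complex.exp (Complex.I * ω * t) * Ψ (r⁻¹ * t) +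
          Complex.exp (Complex.I * ω * t) * Ψ (-r⁻¹ * t)) := fun t => by ring
    simp only [e3]
    rw [integral_const_mul, integral_add (integrable_exp_I_mul_mul hi1 ω)
      (integrable_exp_I_mul_mul hi2 ω), e1, e2, ← mul_add,
      ← integral_add (integrable_exp_I_mul_mul hΨi _) (integrable_exp_I_mul_mul hΨi _),
      ← mul_assoc, show (2 * r : ℂ)⁻¹ * r = 1 / 2 by field_simp, ← integral_const_mul,
      ← integral_indicator measurableSet_Ioo, ← integral_complex_ofReal]
    refine integral_congr_ae (ae_of_all _ fun t => ?_)
    by_cases ht : t ∈ Set.Ioo (0 : ℝ) 1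
    · simp only [hΨ, Set.indicator_of_mem ht]
      push_cast
      rw [Complex.cos, show Complex.I * -(r * ω : ℂ) * t = -(r * ω * t * Complex.I) by ring,
        show Complex.I * (r * ω : ℂ) * t = (r * ω * t * Complex.I) by ring, neg_mul]
      ring
    · simp [hΨ, Set.indicator_of_notMem ht]

theorem bounded (hs : IsPaleyWiener r s) : ∃ C, ∀ ω, ‖s ω‖ ≤ C := by
  obtain ⟨φ, h1, h2, h3⟩ := hs
  refine ⟨∫ t, ‖φ t‖, fun ω => ?_⟩
  rw [h3]
  refine (norm_integral_le_integral_norm _).trans (le_of_eq ?_)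
  simp only [norm_mul, norm_exp_I_mul_mul, one_mul]

/-- Parseval's formula against a function with Fourier transform vanishing on `(-r, r)`. -/
theorem integral_mul_eq_zero (hs : IsPaleyWiener r s) {F : ℝ → ℂ} (hF : Integrable F)
    (h0 : ∀ y : ℝ, |y| < r → ∫ ω : ℝ, Complex.exp (Complex.I * ω * y) * F ω = 0) :
    ∫ ω, s ω * F ω = 0 := by
  obtain ⟨φ, h1, h2, h3⟩ := hs
  have hint : Integrable (fun q : ℝ × ℝ =>
      Complex.exp (Complex.I * q.1 * q.2) * (F q.1 * φ q.2)) (volume.prod volume) :=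
    (hF.mul_prod h1).bdd_mul (c := 1) (by fun_prop)
      (ae_of_all _ fun q => (norm_exp_I_mul_mul q.1 q.2).le)
  calc ∫ ω, s ω * F ω = ∫ ω : ℝ, ∫ t : ℝ, Complex.exp (Complex.I * ω * t) * (F ω * φ t) := by
        refine integral_congr_ae (ae_of_all _ fun ω => ?_)
        simp only
        rw [h3, ← integral_mul_const]
        refine integral_congr_ae (ae_of_all _ fun t => ?_)
        simp only
        ring
    _ = ∫ t : ℝ, ∫ ω : ℝ, Complex.exp (Complex.I * ω * t) * (F ω * φ t) :=
        integral_integral_swap hint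
    _ = 0 := by
        refine integral_eq_zero_of_ae (ae_of_all _ fun t => ?_)
        simp only [← mul_assoc, Pi.zero_apply]
        rw [integral_mul_const]
        rcases lt_or_ge |t| r with ht | ht
        · rw [h0 t ht, zero_mul]
        · rw [h2 t ht, mul_zero]

/-- The inverse Fourier integral of `s` converges to `0` off the support of its transform. -/
theorem tendsto_integral_exp (hs : IsPaleyWiener r s) {τ : ℝ} (hτ : r < |τ|) :
    Tendsto (fun R : ℝ => ∫ ω in (-R)..R, Complex.exp (-Complex.I * ω * τ) * s ω) atTop (𝓝 0) := by
  obtain ⟨φ, h1, h2, h3⟩ := hs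
  -- Integrating `exp(iω(t - τ))` over `[-R, R]` gives two boundary terms over `i(t - τ)`. The
  -- denominator stays away from `0` on the support of `φ`, so `η` is integrable and
  -- Riemann–Lebesgue kills both terms.
  set η : ℝ → ℂ := fun t => φ t / (Complex.I * (t - τ)) with hη
  have hRL : ∀ ε : ℝ, ε ≠ 0 → Tendsto (fun R : ℝ => ∫ t : ℝ,
      Complex.exp (Complex.I * t * (ε * R : ℝ)) * η t) atTop (𝓝 0) := by
    intro ε hε
    simp only [integral_exp_I_eq_fourier]
    refine (Real.zero_at_infty_fourier η).comp ?_
    have hc : -ε / (2 * Real.pi) ≠ 0 := by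
      have := Real.pi_ne_zero
      simp [hε]
    have h : Tendsto (fun R : ℝ => -ε / (2 * Real.pi) * R) (cocompact ℝ) (cocompact ℝ) :=
      tendsto_cocompact_mul_left₀ hc
    refine (h.mono_left atTop_le_cocompact).congr fun R => by ring
  have hb : ∀ (c : ℂ) (R : ℝ), (c = Complex.I ∨ c = -Complex.I) →
      ‖Complex.exp (c * R * τ)‖ = 1 := by
    rintro c R (rfl | rfl)
    · exact norm_exp_I_mul_mul R τ
    · have := norm_exp_I_mul_mul (-R) τ
      rwa [Complex.ofReal_neg, mul_neg, ← neg_mul] at this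
  have hgap : ∀ t : ℝ, |t| < r → |τ| - r ≤ ‖Complex.I * ((t : ℂ) - τ)‖ := fun t ht => by
    rw [norm_mul, Complex.norm_I, one_mul, ← Complex.ofReal_sub, Complex.norm_real,
      Real.norm_eq_abs, abs_sub_comm]
    linarith [abs_sub_abs_le_abs_sub τ t]
  have hηi : Integrable η := by
    refine (h1.norm.const_mul (|τ| - r)⁻¹).mono'
      (h1.aestronglyMeasurable.aemeasurable.div (by fun_prop)).aestronglyMeasurable
      (ae_of_all _ fun t => ?_)
    rcases lt_or_ge |t| r with ht | ht
    · have := hgap t ht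
      have hd : 0 < |τ| - r := by linarith
      rw [hη, norm_div, div_eq_inv_mul]
      gcongr
    · simp [hη, h2 t ht]
  have key : ∀ R : ℝ, 0 ≤ R → ∫ ω in (-R)..R, Complex.exp (-Complex.I * ω * τ) * s ω =
      Complex.exp (-Complex.I * R * τ) * (∫ t : ℝ, Complex.exp (Complex.I * t * (1 * R : ℝ)) * η t) -
      Complex.exp (Complex.I * R * τ) *
        (∫ t : ℝ, Complex.exp (Complex.I * t * (-1 * R : ℝ)) * η t) := by
    intro R hR
    have hint : Integrable (fun q : ℝ × ℝ => Complex.exp (-Complex.I * q.1 * τ) *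
        (Complex.exp (Complex.I * q.1 * q.2) * φ q.2))
        ((volume.restrict (Set.Ioc (-R) R)).prod volume) := by
      have h : Integrable (fun q : ℝ × ℝ => (1 : ℂ) * φ q.2)
        ((volume.restrict (Set.Ioc (-R) R)).prod volume) := (integrable_const 1).mul_prod h1
      simp only [one_mul] at h
      refine (h.bdd_mul (c := 1) (f := fun q : ℝ × ℝ => Complex.exp (Complex.I * q.1 * q.2))
        (by fun_prop) (ae_of_all _ fun q => (norm_exp_I_mul_mul q.1 q.2).le)).bdd_mul (c := 1)
        (by fun_prop) (ae_of_all _ fun q => (hb _ _ (Or.inr rfl)).le)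
    rw [intervalIntegral.integral_of_le (by linarith)]
    simp only [h3, ← integral_const_mul]
    rw [integral_integral_swap hint, ← integral_sub
      ((integrable_exp_I_mul_mul' hηi _).const_mul _) ((integrable_exp_I_mul_mul' hηi _).const_mul _)]
    refine integral_congr_ae (ae_of_all _ fun t => ?_)
    simp only
    rcases lt_or_ge |t| r with ht | ht
    · have hne : Complex.I * ((t : ℂ) - τ) ≠ 0 := by
        rw [← norm_pos_iff]
        linarith [hgap t ht]
      have e : ∀ ω : ℝ, Complex.exp (-Complex.I * ω * τ) * (Complex.exp (Complex.I * ω * t) * φ t) =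
          Complex.exp (Complex.I * (t - τ) * ω) * φ t := fun ω => by
        rw [← mul_assoc, ← Complex.exp_add]
        congr 2
        ring
      simp only [e]
      rw [integral_mul_const, ← intervalIntegral.integral_of_le (by linarith),
        integral_exp_mul_complex hne, ← mul_assoc, ← mul_assoc, ← Complex.exp_add,
        ← Complex.exp_add, hη]
      push_cast
      rw [show -Complex.I * R * τ + Complex.I * t * (1 * R) = Complex.I * (t - τ) * R by ring,
        show Complex.I * R * τ + Complex.I * t * (-1 * R) = Complex.I * (t - τ) * -R by ring]
      ring
    · simp [h2 t ht, hη]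
  have z1 : Tendsto (fun R : ℝ => Complex.exp (-Complex.I * R * τ) *
      (∫ t : ℝ, Complex.exp (Complex.I * t * (1 * R : ℝ)) * η t)) atTop (𝓝 0) := by
    rw [tendsto_zero_iff_norm_tendsto_zero]
    simpa only [norm_mul, hb _ _ (Or.inr rfl), one_mul, norm_zero] using
      (hRL 1 one_ne_zero).norm
  have z2 : Tendsto (fun R : ℝ => Complex.exp (Complex.I * R * τ) *
      (∫ t : ℝ, Complex.exp (Complex.I * t * (-1 * R : ℝ)) * η t)) atTop (𝓝 0) := by
    rw [tendsto_zero_iff_norm_tendsto_zero]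
    simpa only [norm_mul, hb _ _ (Or.inl rfl), one_mul, norm_zero] using
      (hRL (-1) (by norm_num)).norm
  have z := z1.sub z2
  rw [sub_zero] at z
  exact z.congr' ((eventually_ge_atTop 0).mono fun R hR => (key R hR).symm)

end IsPaleyWiener

/-- Multiplication by `ω²` preserves the vanishing of the Fourier transform on `(-r, r)`. -/
theorem integral_exp_I_sq_mul_eq_zero {r : ℝ} {F : ℝ → ℂ}
    (hF : ∀ n : ℕ, n ≤ 2 → Integrable fun ω : ℝ => (ω : ℂ) ^ n * F ω)
    (h0 : ∀ y : ℝ, |y| < r → ∫ ω : ℝ, Complex.exp (Complex.I * ω * y) * F ω = 0)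
    {y : ℝ} (hy : |y| < r) :
    ∫ ω : ℝ, Complex.exp (Complex.I * ω * y) * ((ω : ℂ) ^ 2 * F ω) = 0 := by
  have h := Real.iteratedDeriv_fourier (f := F) (N := 2) (n := 2) (fun n hn => by
    have := hF n (by exact_mod_cast hn)
    simpa [Complex.real_smul] using this) le_rfl
  -- The condition `|y| < r` is open, so the transform vanishes near the point and so does its
  -- second derivative, which is the transform of a multiple of `ω² F`.
  have hz : FourierTransform.fourier F =ᶠ[𝓝 (-y / (2 * Real.pi))] 0 := by
    have hc : Continuous fun v : ℝ => |(-(2 * Real.pi) * v)| := by fun_prop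
    have hv : |(-(2 * Real.pi) * (-y / (2 * Real.pi)))| < r := by
      have : -(2 * Real.pi) * (-y / (2 * Real.pi)) = y := by
        have := Real.pi_ne_zero
        field_simp
      rwa [this]
    filter_upwards [hc.continuousAt.eventually_lt continuousAt_const hv] with v hv
    have h2 := h0 _ hv
    rw [integral_exp_I_eq_fourier] at h2
    have e : -(-(2 * Real.pi) * v) / (2 * Real.pi) = v := by
      have := Real.pi_ne_zero
      field_simp
    rwa [e] at h2
  have h3 : iteratedDeriv 2 (FourierTransform.fourier F) (-y / (2 * Real.pi)) = 0 := by
    rw [hz.iteratedDeriv_eq]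
    simp
  rw [h, ← integral_exp_I_eq_fourier] at h3
  have e : ∀ ω : ℝ, Complex.exp (Complex.I * ω * y) * ((-2 * Real.pi * Complex.I * ω) ^ 2 • F ω) =
      (-2 * Real.pi * Complex.I) ^ 2 *
        (Complex.exp (Complex.I * ω * y) * ((ω : ℂ) ^ 2 * F ω)) := fun ω => by
    rw [smul_eq_mul]; ring
  simp only [e] at h3
  rw [integral_const_mul] at h3
  refine (mul_eq_zero.1 h3).resolve_left (pow_ne_zero _ ?_)
  simp [Real.pi_ne_zero]

/-! ### Growth and exponential type of the symbol -/

/-- The continuation of `modeSymbol (a - 1)` that is smooth across the light cone. -/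
def smoothSymbol (a Z ω k : ℝ) : ℝ :=
  Real.Gamma a * Z ^ a * besselClifford a (Z ^ 2 * (k ^ 2 - ω ^ 2) / 4)

theorem continuous_smoothSymbol {a : ℝ} (ha : 0 < a) (Z : ℝ) :
    Continuous fun q : ℝ × ℝ => smoothSymbol a Z q.1 q.2 :=
  continuous_const.mul ((continuous_besselClifford ha).comp (by fun_prop))

/-- With zero shift and `θ = 2√(-x)`, the cosine integral is bounded by the `L¹` norm of its
density. -/
theorem besselClifford_bounded_of_nonpos {a : ℝ} (ha : 1 / 2 < a) :
    ∃ C, 0 ≤ C ∧ ∀ x ≤ 0, |besselClifford a x| ≤ C := by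
  have hb : 0 < a - 1 / 2 := by linarith
  obtain ⟨C, hC⟩ := (IsPaleyWiener.of_cos one_pos (integrableOn_besselDensity hb 0)).bounded
  refine ⟨C, (norm_nonneg _).trans (hC 0), fun x hx => ?_⟩
  have h := hC (2 * √(-x))
  rwa [one_mul, ← besselClifford_eq_integral_cos hb, Complex.norm_real, Real.norm_eq_abs,
    mul_pow, Real.sq_sqrt (by linarith), sub_add_cancel,
    show 0 - 2 ^ 2 * -x / 4 = x by ring] at h

/-- For `x ≤ 0` the recurrence reduces to the bounded orders `a + 1` and `a + 2`, which costs one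
power of `|x|`; on `[0, B]` compactness suffices. -/
theorem besselClifford_growth {a : ℝ} (ha : 0 < a) (B : ℝ) :
    ∃ C, 0 ≤ C ∧ ∀ x ≤ B, |besselClifford a x| ≤ C * (1 + |x|) := by
  obtain ⟨C₁, h1, hC₁⟩ := besselClifford_bounded_of_nonpos (a := a + 1) (by linarith)
  obtain ⟨C₂, h2, hC₂⟩ := besselClifford_bounded_of_nonpos (a := a + 2) (by linarith)
  obtain ⟨C₃, hC₃⟩ := (isCompact_Icc (a := 0) (b := B)).exists_bound_of_continuousOn
    (continuous_besselClifford ha).continuousOn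
  refine ⟨a * C₁ + C₂ + |C₃|, by positivity, fun x hx => ?_⟩
  have hx0 := abs_nonneg x
  rcases le_total x 0 with h | h
  · rw [besselClifford_recurrence ha]
    calc |a * besselClifford (a + 1) x + x * besselClifford (a + 2) x|
        ≤ a * C₁ + |x| * C₂ := by
          refine (abs_add_le _ _).trans ?_
          rw [abs_mul, abs_mul, abs_of_pos ha]
          gcongr
          · exact hC₁ x h
          · exact hC₂ x h
      _ ≤ _ := by nlinarith [abs_nonneg C₃, mul_nonneg ha.le h1, mul_nonneg (mul_nonneg ha.le h1) hx0,
            mul_nonneg (abs_nonneg C₃) hx0]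
  · have h3 := hC₃ x ⟨h, hx⟩
    rw [Real.norm_eq_abs] at h3
    have h4 := h3.trans (le_abs_self _)
    nlinarith [mul_nonneg (abs_nonneg C₃) hx0, mul_nonneg ha.le h1,
      mul_nonneg (mul_nonneg ha.le h1) hx0, mul_nonneg h2 hx0]

theorem smoothSymbol_growth {a : ℝ} (ha : 0 < a) (Z B : ℝ) :
    ∃ C, ∀ ω k : ℝ, k ^ 2 - ω ^ 2 ≤ B → |smoothSymbol a Z ω k| ≤
      C * ((1 + ω ^ 2) * (1 + k ^ 2)) := by
  obtain ⟨C, hC0, hC⟩ := besselClifford_growth ha (Z ^ 2 * B / 4)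
  refine ⟨|Real.Gamma a * Z ^ a| * (C * (1 + Z ^ 2 / 4)), fun ω k h => ?_⟩
  have h1 := hC (Z ^ 2 * (k ^ 2 - ω ^ 2) / 4) (by gcongr)
  have h2 : |Z ^ 2 * (k ^ 2 - ω ^ 2) / 4| ≤ Z ^ 2 / 4 * (k ^ 2 + ω ^ 2) := by
    rw [show Z ^ 2 * (k ^ 2 - ω ^ 2) / 4 = Z ^ 2 / 4 * (k ^ 2 - ω ^ 2) by ring, abs_mul,
      abs_of_nonneg (by positivity)]
    gcongr
    rw [abs_le]
    constructor <;> nlinarith [sq_nonneg k, sq_nonneg ω]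
  rw [smoothSymbol, abs_mul, mul_assoc, mul_assoc]
  gcongr
  refine h1.trans ?_
  gcongr
  have h3 : 0 ≤ Z ^ 2 / 4 := by positivity
  nlinarith [mul_nonneg (sq_nonneg ω) (sq_nonneg k), mul_nonneg h3 (sq_nonneg ω),
    mul_nonneg h3 (sq_nonneg k), mul_nonneg h3 (mul_nonneg (sq_nonneg ω) (sq_nonneg k)),
    sq_nonneg ω, sq_nonneg k]

/-- Take `θ = Z ω` and shift `Z² k² / 4`: `k` changes only the density, so the radius `Z` is the
same for all `k`. -/
theorem isPaleyWiener_besselClifford {a Z : ℝ} (ha : 1 / 2 < a) (hZ : 0 < Z) (k : ℝ) :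
    IsPaleyWiener Z fun ω => (besselClifford a (Z ^ 2 * (k ^ 2 - ω ^ 2) / 4) : ℂ) := by
  have hb : 0 < a - 1 / 2 := by linarith
  convert IsPaleyWiener.of_cos hZ (integrableOn_besselDensity hb (Z ^ 2 * k ^ 2 / 4)) using 3
    with ω
  rw [← besselClifford_eq_integral_cos hb, sub_add_cancel]
  congr 1
  ring

theorem isPaleyWiener_smoothSymbol {a Z : ℝ} (ha : 1 / 2 < a) (hZ : 0 < Z) (k : ℝ) :
    IsPaleyWiener Z fun ω => (smoothSymbol a Z ω k : ℂ) := by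
  convert (isPaleyWiener_besselClifford ha hZ k).const_mul (Real.Gamma a * Z ^ a : ℝ) using 2
  rw [← Complex.ofReal_mul, smoothSymbol]

/-- In the recurrence the factor `Z² (k² - ω²) / 4` is split: its `k²` part joins `p`, its `ω²` part
gives `q`. -/
theorem exists_isPaleyWiener_smoothSymbol {a Z : ℝ} (ha : 0 < a) (hZ : 0 < Z) (k : ℝ) :
    ∃ p q : ℝ → ℂ, IsPaleyWiener Z p ∧ IsPaleyWiener Z q ∧
      ∀ ω : ℝ, (smoothSymbol a Z ω k : ℂ) = p ω + (ω : ℂ) ^ 2 * q ω := by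
  have h1 := isPaleyWiener_besselClifford (a := a + 1) (by linarith) hZ k
  have h2 := isPaleyWiener_besselClifford (a := a + 2) (by linarith) hZ k
  refine ⟨_, _, (h1.const_mul (Real.Gamma a * Z ^ a * a : ℝ)).add
    (h2.const_mul (Real.Gamma a * Z ^ a * (Z ^ 2 * k ^ 2 / 4) : ℝ)),
    h2.const_mul (-(Real.Gamma a * Z ^ a * (Z ^ 2 / 4)) : ℝ), fun ω => ?_⟩
  rw [smoothSymbol, besselClifford_recurrence ha]
  norm_cast
  ring

/-! ### Identification of the symbol across the light cone -/

/-- The principal square root has argument in `(-π/2, π/2]`, so `(s^(1/2))^μ = s^(μ/2)` without a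
branch jump, also for spacelike momenta, and the powers of `s` cancel. -/
theorem negMomentumSq_cpow_mul_cpow {μ Z ω k : ℝ} (hZ : 0 < Z) (h : ω ^ 2 ≠ k ^ 2 ∨ μ = 0) :
    negMomentumSq ω k ^ (-(μ : ℂ) / 2) * (negMomentumSq ω k ^ (1 / 2 : ℂ) * (Z : ℂ) / 2) ^ (μ : ℂ) =
      ((Z / 2) ^ μ : ℝ) := by
  by_cases hμ : μ = 0
  · simp [hμ]
  have hs : negMomentumSq ω k ≠ 0 := by
    have := h.resolve_right hμ
    rw [negMomentumSq, sub_ne_zero]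
    exact_mod_cast this
  set s := negMomentumSq ω k
  have hw : s ^ (1 / 2 : ℂ) ≠ 0 := by simp [Complex.cpow_eq_zero_iff, hs]
  have hz : ((Z / 2 : ℝ) : ℂ) ≠ 0 := by
    exact_mod_cast (half_pos hZ).ne'
  have hlog : (Complex.log s * (1 / 2)).im = Complex.arg s / 2 := by
    rw [show Complex.log s * (1 / 2) = Complex.log s / (2 : ℝ) by push_cast; ring,
      Complex.div_ofReal_im, Complex.log_im]
  have hπ := Real.pi_pos
  have h1 := Complex.neg_pi_lt_arg s
  have h2 := Complex.arg_le_pi s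
  rw [mul_div_assoc, show (Z : ℂ) / 2 = ((Z / 2 : ℝ) : ℂ) by push_cast; ring, mul_comm (s ^ (1 / 2 : ℂ)),
    Complex.cpow_def_of_ne_zero (mul_ne_zero hz hw), Complex.log_ofReal_mul (half_pos hZ) hw,
    add_mul, Complex.exp_add, ← Complex.cpow_def_of_ne_zero hw,
    ← Complex.cpow_mul _ (by rw [hlog]; linarith) (by rw [hlog]; linarith), mul_left_comm,
    ← Complex.cpow_add _ _ hs, show -(μ : ℂ) / 2 + 1 / 2 * μ = 0 by ring, Complex.cpow_zero,
    mul_one, ← Complex.ofReal_mul, ← Complex.ofReal_exp, Real.rpow_def_of_pos (half_pos hZ)]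

-- On the light cone with `μ ≠ 0` the convention `0 ^ w = 0` replaces the continued value by `0`.
-- For each `k` this affects at most two values of `ω`, so no integral sees it.
open Classical in
theorem modeSymbol_eq {μ Z : ℝ} (hZ : 0 < Z) (ω k : ℝ) :
    modeSymbol μ Z ω k =
      if ω ^ 2 = k ^ 2 ∧ μ ≠ 0 then 0 else (smoothSymbol (1 + μ) Z ω k : ℂ) := by
  split_ifs with h
  · have hs : negMomentumSq ω k = 0 := by
      rw [negMomentumSq, sub_eq_zero]
      exact_mod_cast h.1
    have hne : -(μ : ℂ) / 2 ≠ 0 := by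
      simpa using h.2
    rw [modeSymbol, hs, Complex.zero_cpow hne]
    simp
  · have h' : ω ^ 2 ≠ k ^ 2 ∨ μ = 0 := by tauto
    have hw : (negMomentumSq ω k ^ (1 / 2 : ℂ)) ^ 2 = ((ω ^ 2 - k ^ 2 : ℝ) : ℂ) := by
      rw [← Complex.cpow_nat_mul]
      norm_num [negMomentumSq]
    have hsum : ∑' n : ℕ, ((-1 : ℂ) ^ n / ((n.factorial : ℂ) *
        Complex.Gamma ((n : ℂ) + (μ : ℂ) + 1))) *
        (negMomentumSq ω k ^ (1 / 2 : ℂ) * (Z : ℂ) / 2) ^ (2 * n) =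
        (besselClifford (1 + μ) (Z ^ 2 * (k ^ 2 - ω ^ 2) / 4) : ℂ) := by
      rw [besselClifford, Complex.ofReal_tsum]
      refine tsum_congr fun n => ?_
      rw [pow_mul, div_pow, mul_pow, hw,
        show (n : ℂ) + (μ : ℂ) + 1 = ((1 + μ + n : ℝ) : ℂ) by push_cast; ring, Complex.Gamma_ofReal,
        div_mul_eq_mul_div, ← mul_pow]
      push_cast
      congr 2
      ring
    rw [modeSymbol, radialMode, besselJ, hsum, smoothSymbol,
      show (2 : ℂ) ^ (μ : ℂ) * Complex.Gamma (1 + (μ : ℂ)) * negMomentumSq ω k ^ (-(μ : ℂ) / 2) *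
        ((Z : ℂ) * ((negMomentumSq ω k ^ (1 / 2 : ℂ) * (Z : ℂ) / 2) ^ (μ : ℂ) *
          (besselClifford (1 + μ) (Z ^ 2 * (k ^ 2 - ω ^ 2) / 4) : ℂ))) =
        (2 : ℂ) ^ (μ : ℂ) * Complex.Gamma (1 + (μ : ℂ)) * Z * (negMomentumSq ω k ^ (-(μ : ℂ) / 2) *
          (negMomentumSq ω k ^ (1 / 2 : ℂ) * (Z : ℂ) / 2) ^ (μ : ℂ)) *
          (besselClifford (1 + μ) (Z ^ 2 * (k ^ 2 - ω ^ 2) / 4) : ℂ) by ring,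
      negMomentumSq_cpow_mul_cpow hZ h',
      show (2 : ℂ) ^ (μ : ℂ) = ((2 ^ μ : ℝ) : ℂ) by
        rw [Complex.ofReal_cpow zero_le_two]; norm_num,
      show 1 + (μ : ℂ) = ((1 + μ : ℝ) : ℂ) by push_cast; ring, Complex.Gamma_ofReal]
    norm_cast
    rw [Real.rpow_add hZ, Real.rpow_one, Real.div_rpow hZ.le zero_le_two]
    have : (2 : ℝ) ^ μ ≠ 0 := (Real.rpow_pos_of_pos two_pos μ).ne'
    field_simp

/-! ### Admissible symbols -/

/-- The properties of a momentum-space symbol from which those of the kernel follow. -/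
structure IsAdmissibleSymbol (Z : ℝ) (m : ℝ → ℝ → ℂ) : Prop where
  measurable : Measurable fun q : ℝ × ℝ => m q.1 q.2
  im_eq_zero : ∀ ω k, (m ω k).im = 0
  even : ∀ ω k, m (-ω) (-k) = m ω k
  growth : ∀ B : ℝ, ∃ C, ∀ ω k : ℝ, k ^ 2 - ω ^ 2 ≤ B → ‖m ω k‖ ≤ C * ((1 + ω ^ 2) * (1 + k ^ 2))
  exists_isPaleyWiener : ∀ k : ℝ, ∃ p q : ℝ → ℂ, IsPaleyWiener Z p ∧ IsPaleyWiener Z q ∧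
    ∀ᵐ ω : ℝ, m ω k = p ω + (ω : ℂ) ^ 2 * q ω

theorem modeSymbol_ae_eq {μ Z : ℝ} (hZ : 0 < Z) (k : ℝ) :
    ∀ᵐ ω : ℝ, modeSymbol μ Z ω k = (smoothSymbol (1 + μ) Z ω k : ℂ) := by
  have hfin : ({k, -k} : Set ℝ).Finite := Set.toFinite _
  filter_upwards [hfin.countable.ae_notMem volume] with ω hω
  rw [modeSymbol_eq hZ, if_neg]
  rintro ⟨h, -⟩
  exact hω (by simpa using sq_eq_sq_iff_eq_or_eq_neg.1 h)

theorem isAdmissibleSymbol_modeSymbol {μ Z : ℝ} (hμ : -1 < μ) (hZ : 0 < Z) :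
    IsAdmissibleSymbol Z (modeSymbol μ Z) := by
  classical
  have ha : 0 < 1 + μ := by linarith
  have hm := modeSymbol_eq (μ := μ) hZ
  refine ⟨?_, fun ω k => ?_, fun ω k => ?_, fun B => ?_, fun k => ?_⟩
  · simp only [hm]
    refine Measurable.ite ?_ measurable_const
      (Complex.continuous_ofReal.comp (continuous_smoothSymbol ha Z)).measurable
    by_cases h : μ = 0
    · simp [h]
    · simp only [ne_eq, h, not_false_eq_true, and_true]
      exact measurableSet_eq_fun (by fun_prop) (by fun_prop)
  · rw [hm]
    split_ifs <;> simp
  · simp only [hm, neg_sq, smoothSymbol]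
  · obtain ⟨C, hC⟩ := smoothSymbol_growth ha Z B
    refine ⟨C, fun ω k h => ?_⟩
    have h1 := hC ω k h
    rw [hm]
    split_ifs
    · simpa using (abs_nonneg _).trans h1
    · simpa using h1
  · obtain ⟨p, q, hp, hq, h⟩ := exists_isPaleyWiener_smoothSymbol ha hZ k
    refine ⟨p, q, hp, hq, ?_⟩
    filter_upwards [modeSymbol_ae_eq hZ k] with ω hω
    rw [hω, h]

theorem IsAdmissibleSymbol.linear_combination {Z : ℝ} {m m' : ℝ → ℝ → ℂ}
    (hm : IsAdmissibleSymbol Z m) (hm' : IsAdmissibleSymbol Z m') (c c' : ℝ) :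
    IsAdmissibleSymbol Z fun ω k => (c : ℂ) * m ω k + (c' : ℂ) * m' ω k := by
  refine ⟨(hm.measurable.const_mul _).add (hm'.measurable.const_mul _), fun ω k => ?_,
    fun ω k => ?_, fun B => ?_, fun k => ?_⟩
  · simp [hm.im_eq_zero, hm'.im_eq_zero]
  · rw [hm.even, hm'.even]
  · obtain ⟨C, hC⟩ := hm.growth B
    obtain ⟨C', hC'⟩ := hm'.growth B
    refine ⟨|c| * C + |c'| * C', fun ω k h => (norm_add_le _ _).trans ?_⟩
    rw [norm_mul, norm_mul, Complex.norm_real, Complex.norm_real, Real.norm_eq_abs,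
      Real.norm_eq_abs, add_mul, mul_assoc, mul_assoc]
    gcongr
    · exact hC ω k h
    · exact hC' ω k h
  · obtain ⟨p, q, hp, hq, h⟩ := hm.exists_isPaleyWiener k
    obtain ⟨p', q', hp', hq', h'⟩ := hm'.exists_isPaleyWiener k
    refine ⟨_, _, (hp.const_mul c).add (hp'.const_mul c'), (hq.const_mul c).add (hq'.const_mul c'),
      ?_⟩
    filter_upwards [h, h'] with ω h1 h2
    rw [h1, h2]
    ring

/-! ### Decay of the transform, and definedness -/

theorem norm_planeWave (T' X' ω k : ℝ) (p : ℝ × ℝ) : ‖planeWave T' X' ω k p‖ = 1 := by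
  rw [planeWave, show -Complex.I * ω * (T' - p.1) + Complex.I * k * (X' - p.2) =
    ((-ω * (T' - p.1) + k * (X' - p.2) : ℝ) : ℂ) * Complex.I by push_cast; ring,
    Complex.norm_exp_ofReal_mul_I]

/-- Transport to the Euclidean plane, which has the inner product the Fourier transform needs. The
bulk point enters only through a phase, so decay bounds are uniform in it. -/
theorem exists_schwartz_waveTransform_eq (f : 𝓢(ℝ × ℝ, ℂ)) :
    ∃ g : 𝓢(WithLp 2 (ℝ × ℝ), ℂ), ∀ T' X' ω k : ℝ, waveTransform T' X' f ω k =
      planeWave T' X' ω k 0 * g (WithLp.toLp 2 (-ω / (2 * Real.pi), k / (2 * Real.pi))) := by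
  refine ⟨FourierTransform.fourier (SchwartzMap.compCLMOfContinuousLinearEquiv ℝ
    (WithLp.prodContinuousLinearEquiv 2 ℝ ℝ ℝ) f), fun T' X' ω k => ?_⟩
  rw [SchwartzMap.fourier_coe, Real.fourier_eq', waveTransform, ← integral_const_mul,
    ← (WithLp.volume_preserving_ofLp ℝ ℝ).integral_comp
      (MeasurableEquiv.toLp 2 (ℝ × ℝ)).symm.measurableEmbedding]
  refine integral_congr_ae (ae_of_all _ fun v => ?_)
  simp only [smul_eq_mul, SchwartzMap.compCLMOfContinuousLinearEquiv_apply, Function.comp,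
    WithLp.prod_inner_apply, planeWave, ← mul_assoc, ← Complex.exp_add]
  congr 2
  have := Real.pi_ne_zero
  simp
  field_simp
  ring

theorem continuous_waveTransform (T' X' : ℝ) (f : 𝓢(ℝ × ℝ, ℂ)) :
    Continuous fun q : ℝ × ℝ => waveTransform T' X' f q.1 q.2 := by
  obtain ⟨g, hg⟩ := exists_schwartz_waveTransform_eq f
  simp only [hg, planeWave]
  have h : Continuous fun q : ℝ × ℝ =>
      (WithLp.toLp 2 (-q.1 / (2 * Real.pi), q.2 / (2 * Real.pi)) : WithLp 2 (ℝ × ℝ)) :=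
    (WithLp.prodContinuousLinearEquiv 2 ℝ ℝ ℝ).symm.continuous.comp
      (f := fun q : ℝ × ℝ => (-q.1 / (2 * Real.pi), q.2 / (2 * Real.pi))) (by fun_prop)
  exact (by fun_prop : Continuous _).mul (g.continuous.comp h)

/-- One power of the weight absorbs the growth of the symbol, the other leaves an integrable
majorant. The squared weight is of order eight in the momentum, whence the seminorms of order `8`.
-/
theorem waveTransform_decay (f : 𝓢(ℝ × ℝ, ℂ)) : ∃ C, 0 ≤ C ∧ ∀ T' X' ω k : ℝ,
    ((1 + ω ^ 2) * (1 + k ^ 2)) ^ 2 * ‖waveTransform T' X' f ω k‖ ≤ C := by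
  obtain ⟨g, hg⟩ := exists_schwartz_waveTransform_eq f
  have hd := g.one_add_le_sup_seminorm_apply (𝕜 := ℝ) (m := (8, 0)) (k := 8) (n := 0) le_rfl le_rfl
  set D := 2 ^ (8, 0).1 * (Finset.Iic (8, 0)).sup (fun m => SchwartzMap.seminorm ℝ m.1 m.2) g with hD
  have hD0 : 0 ≤ D := le_trans (by positivity) (hd 0)
  refine ⟨(4 * Real.pi ^ 2) ^ 4 * D, by positivity, fun T' X' ω k => ?_⟩
  set ξ : WithLp 2 (ℝ × ℝ) := WithLp.toLp 2 (-ω / (2 * Real.pi), k / (2 * Real.pi)) with hξ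
  have hn : ‖ξ‖ ^ 2 = (ω ^ 2 + k ^ 2) / (4 * Real.pi ^ 2) := by
    rw [WithLp.prod_norm_sq_eq_of_L2]
    change ‖-ω / (2 * Real.pi)‖ ^ 2 + ‖k / (2 * Real.pi)‖ ^ 2 = _
    simp only [Real.norm_eq_abs, sq_abs]
    have := Real.pi_ne_zero
    field_simp
    ring
  have hπ : 1 ≤ 4 * Real.pi ^ 2 := by nlinarith [Real.pi_gt_three]
  have hs : 1 + (ω ^ 2 + k ^ 2) ≤ 4 * Real.pi ^ 2 * (1 + ‖ξ‖) ^ 2 := by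
    have h1 : ω ^ 2 + k ^ 2 = 4 * Real.pi ^ 2 * ‖ξ‖ ^ 2 := by
      rw [hn]; have := Real.pi_ne_zero; field_simp
    rw [h1]
    nlinarith [norm_nonneg ξ, mul_nonneg (zero_le_one.trans hπ) (norm_nonneg ξ)]
  have h2 : (1 + ω ^ 2) * (1 + k ^ 2) ≤ (4 * Real.pi ^ 2 * (1 + ‖ξ‖) ^ 2) ^ 2 := by
    refine le_trans ?_ (pow_le_pow_left₀ (by positivity) hs 2)
    nlinarith [sq_nonneg ω, sq_nonneg k, mul_nonneg (sq_nonneg ω) (sq_nonneg k), sq_nonneg (ω ^ 2),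
      sq_nonneg (k ^ 2)]
  have h3 := hd ξ
  rw [norm_iteratedFDeriv_zero] at h3
  rw [hg, norm_mul, norm_planeWave, one_mul]
  calc ((1 + ω ^ 2) * (1 + k ^ 2)) ^ 2 * ‖g ξ‖
      ≤ ((4 * Real.pi ^ 2 * (1 + ‖ξ‖) ^ 2) ^ 2) ^ 2 * ‖g ξ‖ := by gcongr
    _ = (4 * Real.pi ^ 2) ^ 4 * ((1 + ‖ξ‖) ^ 8 * ‖g ξ‖) := by ring
    _ ≤ _ := by gcongr

theorem integrable_inv_one_add_sq_prod :
    Integrable fun q : ℝ × ℝ => ((1 + q.1 ^ 2) * (1 + q.2 ^ 2))⁻¹ := by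
  simp only [mul_inv]
  exact integrable_inv_one_add_sq.mul_prod integrable_inv_one_add_sq

/-- A symbol with polynomial growth on the support of the transform gives a rapidly decaying
product. -/
theorem norm_mul_waveTransform_le {T' X' : ℝ} {f : 𝓢(ℝ × ℝ, ℂ)} {C D ω k : ℝ} {z : ℂ}
    (hz : ‖z‖ ≤ C * ((1 + ω ^ 2) * (1 + k ^ 2)))
    (hD : ((1 + ω ^ 2) * (1 + k ^ 2)) ^ 2 * ‖waveTransform T' X' f ω k‖ ≤ D) :
    ‖z * waveTransform T' X' f ω k‖ ≤ C * D * ((1 + ω ^ 2) * (1 + k ^ 2))⁻¹ := by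
  set W := (1 + ω ^ 2) * (1 + k ^ 2)
  have hW : 0 < W := by positivity
  have hC : 0 ≤ C := by
    by_contra hc
    have := (norm_nonneg z).trans hz
    nlinarith
  rw [norm_mul, ← div_eq_mul_inv, le_div_iff₀ hW]
  calc ‖z‖ * ‖waveTransform T' X' f ω k‖ * W ≤ C * W * ‖waveTransform T' X' f ω k‖ * W := by gcongr
    _ = C * (W ^ 2 * ‖waveTransform T' X' f ω k‖) := by ring
    _ ≤ _ := by gcongr

variable {Z : ℝ} {m : ℝ → ℝ → ℂ}

theorem IsAdmissibleSymbol.integrable_mul_waveTransform (hm : IsAdmissibleSymbol Z m) (T' X' : ℝ)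
    (f : 𝓢(ℝ × ℝ, ℂ)) (k : ℝ) : Integrable fun ω : ℝ => m ω k * waveTransform T' X' f ω k := by
  -- At fixed `k` the spacelike size `k² - ω²` never exceeds `k²`, so no spectral condition on `f`
  -- is needed.
  obtain ⟨C, hC⟩ := hm.growth (k ^ 2)
  obtain ⟨D, -, hD⟩ := waveTransform_decay f
  refine (integrable_inv_one_add_sq.const_mul (C * D * (1 + k ^ 2)⁻¹)).mono' ?_
    (ae_of_all _ fun ω => ?_)
  · have h1 : Measurable fun ω : ℝ => m ω k := hm.measurable.comp (measurable_id.prodMk measurable_const)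
    have h2 : Continuous fun ω : ℝ => waveTransform T' X' f ω k :=
      (continuous_waveTransform T' X' f).comp (f := fun ω : ℝ => (ω, k)) (by fun_prop)
    exact (h1.mul h2.measurable).aestronglyMeasurable
  · refine (norm_mul_waveTransform_le (hC ω k (by nlinarith [sq_nonneg ω])) (hD T' X' ω k)).trans
      (le_of_eq ?_)
    rw [mul_inv]
    ring

theorem IsAdmissibleSymbol.isDefinedKernel (hm : IsAdmissibleSymbol Z m) (T' X' : ℝ) :
    IsDefinedKernel m T' X' := by
  intro f B hB
  obtain ⟨C, hC⟩ := hm.growth B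
  obtain ⟨D, -, hD⟩ := waveTransform_decay f
  have hint : Integrable (fun q : ℝ × ℝ => m q.1 q.2 * waveTransform T' X' f q.1 q.2) := by
    have hC' : ∀ ω k : ℝ, k ^ 2 - ω ^ 2 ≤ B →
        ‖m ω k‖ ≤ |C| * ((1 + ω ^ 2) * (1 + k ^ 2)) := fun ω k h =>
      (hC ω k h).trans (by gcongr; exact le_abs_self C)
    refine (integrable_inv_one_add_sq_prod.const_mul (|C| * D)).mono'
      (hm.measurable.mul (continuous_waveTransform T' X' f).measurable).aestronglyMeasurable
      (ae_of_all _ fun q => ?_)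
    rcases le_or_gt (q.2 ^ 2 - q.1 ^ 2) B with h | h
    · exact norm_mul_waveTransform_le (hC' _ _ h) (hD T' X' q.1 q.2)
    · have hD0 : 0 ≤ D := le_trans (by positivity) (hD T' X' 0 0)
      rw [hB _ _ h, mul_zero, norm_zero]
      positivity
  exact ⟨⟨hm.integrable_mul_waveTransform T' X' f, hint.integral_prod_right⟩, hint⟩

/-! ### Reality -/

theorem conj_planeWave (T' X' ω k : ℝ) (p : ℝ × ℝ) :
    (starRingEnd ℂ) (planeWave T' X' ω k p) = planeWave T' X' (-ω) (-k) p := by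
  rw [planeWave, planeWave, ← Complex.exp_conj]
  simp

theorem conj_waveTransform (T' X' : ℝ) {f : 𝓢(ℝ × ℝ, ℂ)} (hf : ∀ p, (f p).im = 0) (ω k : ℝ) :
    (starRingEnd ℂ) (waveTransform T' X' f ω k) = waveTransform T' X' f (-ω) (-k) := by
  rw [waveTransform, waveTransform, ← integral_conj]
  refine integral_congr_ae (ae_of_all _ fun p => ?_)
  simp only
  rw [map_mul, conj_planeWave, Complex.conj_eq_iff_im.2 (hf p)]

theorem IsAdmissibleSymbol.conj (hm : IsAdmissibleSymbol Z m) (ω k : ℝ) :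
    (starRingEnd ℂ) (m ω k) = m (-ω) (-k) := by
  rw [hm.even, Complex.conj_eq_iff_im.2 (hm.im_eq_zero ω k)]

theorem im_integral_eq_zero {g : ℝ → ℂ} (hg : ∀ k, (starRingEnd ℂ) (g k) = g (-k)) :
    (∫ k, g k).im = 0 := by
  rw [← Complex.conj_eq_iff_im, ← integral_conj]
  simp only [hg]
  exact integral_neg_eq_self g volume

theorem IsAdmissibleSymbol.isRealKernel (hm : IsAdmissibleSymbol Z m) (T' X' : ℝ) :
    IsRealKernel m T' X' := by
  refine ⟨fun f _ hf => ?_, ?_⟩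
  · rw [kernelPairing, Complex.im_ofReal_mul, im_integral_eq_zero, mul_zero]
    intro k
    rw [← integral_conj, ← integral_neg_eq_self]
    refine integral_congr_ae (ae_of_all _ fun ω => ?_)
    simp only
    rw [map_mul, hm.conj, conj_waveTransform T' X' hf, neg_neg]
  · rintro p c ⟨g, hg, -, rfl⟩
    rw [Complex.im_ofReal_mul, im_integral_eq_zero, mul_zero]
    intro k
    -- Conjugation together with `ω ↦ -ω` maps the truncated integrals at `k` to those at `-k`;
    -- uniqueness of limits gives the symmetry of `g`.
    have h1 := (Complex.continuous_conj.tendsto _).comp (hg k)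
    refine tendsto_nhds_unique h1 ((hg (-k)).congr fun R => ?_)
    simp only [Function.comp]
    rw [← intervalIntegral.intervalIntegral_conj]
    have h3 := intervalIntegral.integral_comp_neg (a := -R) (b := R)
      (fun ω => planeWave T' X' ω (-k) p * m ω (-k))
    rw [neg_neg] at h3
    rw [← h3]
    simp only [map_mul, conj_planeWave, hm.conj]

/-! ### Fourier inversion in time, and spacelike support -/

theorem IsPaleyWiener.continuous {r : ℝ} {s : ℝ → ℂ} (hs : IsPaleyWiener r s) : Continuous s := by
  obtain ⟨φ, h1, -, h3⟩ := hs
  rw [funext h3]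
  refine continuous_of_dominated (bound := fun t => ‖φ t‖)
    (fun ω => (integrable_exp_I_mul_mul h1 ω).aestronglyMeasurable)
    (fun ω => ae_of_all _ fun t => ?_) h1.norm (ae_of_all _ fun t => by fun_prop)
  rw [norm_mul, norm_exp_I_mul_mul, one_mul]

theorem IsPaleyWiener.integrable_mul {r : ℝ} {s : ℝ → ℂ} (hs : IsPaleyWiener r s) {F : ℝ → ℂ}
    (hF : Integrable F) : Integrable fun ω => s ω * F ω := by
  obtain ⟨C, hC⟩ := hs.bounded
  exact hF.bdd_mul hs.continuous.aestronglyMeasurable (ae_of_all _ hC)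

theorem integrable_pow_mul_waveTransform (T' X' : ℝ) (f : 𝓢(ℝ × ℝ, ℂ)) (k : ℝ) {n : ℕ}
    (hn : n ≤ 2) : Integrable fun ω : ℝ => (ω : ℂ) ^ n * waveTransform T' X' f ω k := by
  obtain ⟨D, -, hD⟩ := waveTransform_decay f
  refine (integrable_inv_one_add_sq.const_mul (1 * D * (1 + k ^ 2)⁻¹)).mono' ?_
    (ae_of_all _ fun ω => ?_)
  · have h2 : Continuous fun ω : ℝ => waveTransform T' X' f ω k :=
      (continuous_waveTransform T' X' f).comp (f := fun ω : ℝ => (ω, k)) (by fun_prop)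
    exact ((by fun_prop : Continuous fun ω : ℝ => (ω : ℂ) ^ n).mul h2).aestronglyMeasurable
  · have hpow : ‖(ω : ℂ) ^ n‖ ≤ 1 * ((1 + ω ^ 2) * (1 + k ^ 2)) := by
      have h1 : |ω| ^ n ≤ 1 + ω ^ 2 := by
        rw [← sq_abs ω]
        interval_cases n <;> nlinarith [sq_nonneg (|ω| - 1), sq_nonneg |ω|]
      rw [norm_pow, Complex.norm_real, Real.norm_eq_abs]
      nlinarith [sq_nonneg k, sq_nonneg ω, mul_nonneg (sq_nonneg ω) (sq_nonneg k)]
    refine (norm_mul_waveTransform_le hpow (hD T' X' ω k)).trans (le_of_eq ?_)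
    rw [mul_inv]
    ring

/-- The partial Fourier transform of a test function in the spatial variable. -/
def spatialTransform (X' : ℝ) (f : 𝓢(ℝ × ℝ, ℂ)) (k T : ℝ) : ℂ :=
  ∫ X : ℝ, Complex.exp (Complex.I * k * (X' - X)) * f (T, X)

theorem norm_exp_I_mul_sub (k X' X : ℝ) : ‖Complex.exp (Complex.I * k * (X' - X))‖ = 1 := by
  have := norm_exp_I_mul_mul k (X' - X)
  rwa [Complex.ofReal_sub] at this

/-- Continuity is what makes Fourier inversion hold at every time, not merely almost everywhere. -/
theorem continuous_spatialTransform (X' : ℝ) (f : 𝓢(ℝ × ℝ, ℂ)) (k : ℝ) :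
    Continuous (spatialTransform X' f k) := by
  have hd := f.one_add_le_sup_seminorm_apply (𝕜 := ℝ) (m := (2, 0)) (k := 2) (n := 0) le_rfl le_rfl
  set D := 2 ^ (2, 0).1 * (Finset.Iic (2, 0)).sup (fun m => SchwartzMap.seminorm ℝ m.1 m.2) f with hD
  refine continuous_of_dominated (bound := fun X => D * (1 + X ^ 2)⁻¹) (fun T => ?_)
    (fun T => ae_of_all _ fun X => ?_) (integrable_inv_one_add_sq.const_mul D)
    (ae_of_all _ fun X => ?_)
  · exact (Continuous.mul (by fun_prop) (f.continuous.comp (by fun_prop))).aestronglyMeasurable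
  · rw [norm_mul, norm_exp_I_mul_sub, one_mul, ← div_eq_mul_inv, le_div_iff₀ (by positivity)]
    have h := hd (T, X)
    rw [norm_iteratedFDeriv_zero] at h
    refine le_trans ?_ h
    rw [mul_comm]
    gcongr
    have h1 : |X| ≤ ‖(T, X)‖ := norm_snd_le (T, X)
    rw [← sq_abs X]
    nlinarith [abs_nonneg X]
  · exact continuous_const.mul (f.continuous.comp (by fun_prop))

theorem integrable_planeWave_mul (T' X' : ℝ) (f : 𝓢(ℝ × ℝ, ℂ)) (ω k : ℝ) :
    Integrable fun p : ℝ × ℝ => planeWave T' X' ω k p * f p := by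
  refine (f.integrable (μ := volume)).bdd_mul (c := 1) ?_
    (ae_of_all _ fun p => (norm_planeWave T' X' ω k p).le)
  unfold planeWave
  exact Continuous.aestronglyMeasurable (by fun_prop)

theorem integrable_spatialTransform (X' : ℝ) (f : 𝓢(ℝ × ℝ, ℂ)) (k : ℝ) :
    Integrable (spatialTransform X' f k) := by
  have h := (integrable_planeWave_mul 0 X' f 0 k).integral_prod_left
  refine h.congr (ae_of_all _ fun T => ?_)
  simp [planeWave, spatialTransform]

theorem waveTransform_eq_fourier (T' X' : ℝ) (f : 𝓢(ℝ × ℝ, ℂ)) (ω k : ℝ) :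
    waveTransform T' X' f ω k = Complex.exp (-Complex.I * ω * T') *
      FourierTransform.fourier (spatialTransform X' f k) (-ω / (2 * Real.pi)) := by
  rw [waveTransform, Measure.volume_eq_prod, integral_prod _ (integrable_planeWave_mul T' X' f ω k),
    ← integral_exp_I_eq_fourier, ← integral_const_mul]
  refine integral_congr_ae (ae_of_all _ fun T => ?_)
  simp only [spatialTransform]
  rw [← integral_const_mul, ← integral_const_mul]
  refine integral_congr_ae (ae_of_all _ fun X => ?_)
  simp only [planeWave, ← mul_assoc, ← Complex.exp_add]
  congr 2
  ring

/-- Fourier inversion in the time variable. -/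
theorem integral_exp_I_mul_waveTransform (T' X' : ℝ) (f : 𝓢(ℝ × ℝ, ℂ)) (k y : ℝ) :
    ∫ ω : ℝ, Complex.exp (Complex.I * ω * y) * waveTransform T' X' f ω k =
      2 * Real.pi * spatialTransform X' f k (T' - y) := by
  have hπ := Real.pi_ne_zero
  have hc : -(2 * Real.pi) ≠ 0 := by simp [hπ]
  set h := spatialTransform X' f k
  have hF : ∀ v : ℝ, FourierTransform.fourier h v =
      Complex.exp (Complex.I * (-(2 * Real.pi) * v : ℝ) * T') *
        waveTransform T' X' f (-(2 * Real.pi) * v) k := fun v => by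
    rw [waveTransform_eq_fourier, ← mul_assoc, ← Complex.exp_add]
    have e : -(-(2 * Real.pi) * v) / (2 * Real.pi) = v := by field_simp
    rw [e]
    ring_nf
    simp [h]
  have hint : Integrable (FourierTransform.fourier h) := by
    have h0 := integrable_pow_mul_waveTransform T' X' f k (n := 0) (by norm_num)
    simp only [pow_zero, one_mul] at h0
    have h1 := (integrable_exp_I_mul_mul' h0 T').comp_mul_left' hc
    exact h1.congr (ae_of_all _ fun v => (hF v).symm)
  have hinv := congrFun ((continuous_spatialTransform X' f k).fourierInv_fourier_eq
    (integrable_spatialTransform X' f k) hint) (T' - y)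
  rw [Real.fourierInv_eq'] at hinv
  -- The substitution `ω = -2π v` matches the physical sign and normalization with the standard
  -- transform.
  have hsub := Measure.integral_comp_mul_left
    (fun ω : ℝ => Complex.exp (Complex.I * ω * y) * waveTransform T' X' f ω k) (-(2 * Real.pi))
  have hab : |(-(2 * Real.pi))⁻¹| = (2 * Real.pi)⁻¹ := by
    rw [abs_inv, abs_neg, abs_of_pos Real.two_pi_pos]
  rw [hab, Complex.real_smul] at hsub
  have heq : ∫ v : ℝ, Complex.exp (Complex.I * (-(2 * Real.pi) * v : ℝ) * y) *
      waveTransform T' X' f (-(2 * Real.pi) * v) k = h (T' - y) := by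
    refine Eq.trans ?_ hinv
    refine integral_congr_ae (ae_of_all _ fun v => ?_)
    simp only [smul_eq_mul]
    rw [hF, ← mul_assoc, ← Complex.exp_add]
    congr 2
    simp
    ring
  rw [heq] at hsub
  have hπ2 : (2 * Real.pi : ℂ) * ((2 * Real.pi)⁻¹ : ℝ) = 1 := by
    have : (Real.pi : ℂ) ≠ 0 := by exact_mod_cast hπ
    push_cast
    field_simp
  change _ = 2 * (Real.pi : ℂ) * h (T' - y)
  rw [hsub, ← mul_assoc, hπ2, one_mul]

/-- The boundary points whose time differs from `T'` by more than `Z`. -/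
def timeGapRegion (T' Z : ℝ) : Set (ℝ × ℝ) := {p | Z < |T' - p.1|}

theorem isOpen_timeGapRegion (T' Z : ℝ) : IsOpen (timeGapRegion T' Z) :=
  isOpen_lt continuous_const (by fun_prop)

/-- Either the interval is strictly negative or `ΔX² > 0`; both force `ΔT² > Z'²`. The excluded
lightlike points with `ΔX = 0` have `|ΔT| = Z'`, on the edge of the open region. -/
theorem timelikeRegion_union_lightlikeRegion_subset (T' X' Z' : ℝ) :
    timelikeRegion T' X' Z' ∪ lightlikeRegion T' X' Z' ⊆ timeGapRegion T' Z' := by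
  intro p hp
  have h : Z' ^ 2 < (T' - p.1) ^ 2 := by
    rcases hp with h | ⟨h, hne⟩
    · have h' : (X' - p.2) ^ 2 + Z' ^ 2 - (T' - p.1) ^ 2 < 0 := h
      nlinarith [sq_nonneg (X' - p.2)]
    · rw [boundaryInterval] at h
      have : 0 < (X' - p.2) ^ 2 := by
        have : X' - p.2 ≠ 0 := sub_ne_zero.2 hne.symm
        positivity
      linarith
  exact lt_of_le_of_lt (le_abs_self Z') (sq_lt_sq.1 h)

/-- By inversion in time, the Fourier transform in `ω` at `y` sees `f` only on the slice `T = T' -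
y`, which misses the support for `|y| < Z`. Parseval against `p`, and against `q` with the extra
`ω²`, gives zero. -/
theorem IsAdmissibleSymbol.integral_mul_waveTransform_eq_zero (hm : IsAdmissibleSymbol Z m)
    {T' : ℝ} (X' : ℝ) {f : 𝓢(ℝ × ℝ, ℂ)} (hf : tsupport (f : ℝ × ℝ → ℂ) ⊆ timeGapRegion T' Z) (k : ℝ) :
    ∫ ω : ℝ, m ω k * waveTransform T' X' f ω k = 0 := by
  have h0 : ∀ y : ℝ, |y| < Z →
      ∫ ω : ℝ, Complex.exp (Complex.I * ω * y) * waveTransform T' X' f ω k = 0 := fun y hy => by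
    have : spatialTransform X' f k (T' - y) = 0 := by
      rw [spatialTransform]
      refine integral_eq_zero_of_ae (ae_of_all _ fun X => ?_)
      have hX : f (T' - y, X) = 0 := by
        by_contra hne
        have h1 : Z < |T' - (T' - y)| := hf (subset_tsupport _ hne)
        rw [sub_sub_cancel] at h1
        linarith
      simp [hX]
    rw [integral_exp_I_mul_waveTransform, this, mul_zero]
  have hpow := fun n (hn : n ≤ 2) => integrable_pow_mul_waveTransform T' X' f k hn
  have hi0 := hpow 0 (by norm_num)
  simp only [pow_zero, one_mul] at hi0
  have hi2 := hpow 2 le_rfl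
  obtain ⟨p, q, hp, hq, h⟩ := hm.exists_isPaleyWiener k
  have hae : (fun ω : ℝ => m ω k * waveTransform T' X' f ω k) =ᵐ[volume] fun ω =>
      p ω * waveTransform T' X' f ω k + q ω * ((ω : ℂ) ^ 2 * waveTransform T' X' f ω k) := by
    filter_upwards [h] with ω hω
    rw [hω]
    ring
  rw [integral_congr_ae hae, integral_add (hp.integrable_mul hi0) (hq.integrable_mul hi2),
    hp.integral_mul_eq_zero hi0 h0,
    hq.integral_mul_eq_zero hi2 fun y hy => integral_exp_I_sq_mul_eq_zero hpow h0 hy, add_zero]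

theorem IsAdmissibleSymbol.hasSpacelikeSupport (hm : IsAdmissibleSymbol Z m) (T' X' : ℝ) :
    HasSpacelikeSupport m T' X' Z := by
  refine ⟨timeGapRegion T' Z, isOpen_timeGapRegion T' Z,
    timelikeRegion_union_lightlikeRegion_subset T' X' Z, fun f hf => ?_⟩
  have h := hm.integral_mul_waveTransform_eq_zero X' hf
  refine ⟨⟨hm.integrable_mul_waveTransform T' X' f, ?_⟩, ?_⟩
  -- Since the inner integral is identically zero, integrability in `k` holds despite the
  -- exponential growth of the symbol.
  · simp only [h]
    exact integrable_zero _ _ _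
  · simp [kernelPairing, h]

/-! ### Pointwise vanishing and conclusion -/

theorem vanishesPointwise_of_isPaleyWiener (T' X' : ℝ)
    (hm : ∀ k : ℝ, ∃ s : ℝ → ℂ, IsPaleyWiener Z s ∧ ∀ᵐ ω : ℝ, m ω k = s ω) :
    VanishesPointwise m T' X' Z := by
  intro p hp
  have hτ : Z < |T' - p.1| := timelikeRegion_union_lightlikeRegion_subset T' X' Z hp
  refine ⟨fun _ => 0, fun k => ?_, integrable_zero _ _ _, by simp⟩
  obtain ⟨s, hs, h⟩ := hm k
  have ht := (hs.tendsto_integral_exp hτ).const_mul (Complex.exp (Complex.I * k * (X' - p.2)))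
  rw [mul_zero] at ht
  refine ht.congr fun R => ?_
  rw [← intervalIntegral.integral_const_mul]
  refine intervalIntegral.integral_congr_ae ?_
  filter_upwards [h] with ω hω _
  rw [hω, planeWave, ← mul_assoc, ← Complex.exp_add]
  congr 2
  push_cast
  ring

/-- Here `a = 1 + μ > 1/2`, so the density `(1 - t²)^(μ - 1/2)` is integrable and no `ω²` term is
needed. Applied to `-ν`, this is the source of `ν < 1/2` in the Robin case. -/
theorem exists_isPaleyWiener_modeSymbol {μ Z : ℝ} (hμ : -(1 / 2) < μ) (hZ : 0 < Z) (k : ℝ) :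
    ∃ s : ℝ → ℂ, IsPaleyWiener Z s ∧ ∀ᵐ ω : ℝ, modeSymbol μ Z ω k = s ω :=
  ⟨_, isPaleyWiener_smoothSymbol (by linarith) hZ k, modeSymbol_ae_eq hZ k⟩

end

theorem mainTheorem2 (T' X' Z' : ℝ) (hZ : 0 < Z') :
    (∀ ν : ℝ, 0 ≤ ν →
      IsDefinedKernel (dirichletSymbol ν Z') T' X' ∧
      IsRealKernel (dirichletSymbol ν Z') T' X' ∧
      HasSpacelikeSupport (dirichletSymbol ν Z') T' X' Z' ∧
      VanishesPointwise (dirichletSymbol ν Z') T' X' Z') ∧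
    (∀ ν γ : ℝ, 0 < ν → ν < 1 →
      IsDefinedKernel (robinSymbol ν γ Z') T' X' ∧
      IsRealKernel (robinSymbol ν γ Z') T' X' ∧
      HasSpacelikeSupport (robinSymbol ν γ Z') T' X' Z' ∧
      (ν < 1 / 2 → VanishesPointwise (robinSymbol ν γ Z') T' X' Z')) := by
  refine ⟨fun ν hν => ?_, fun ν γ hν hν1 => ?_⟩
  · have hm : IsAdmissibleSymbol Z' (dirichletSymbol ν Z') :=
      isAdmissibleSymbol_modeSymbol (by linarith) hZ
    exact ⟨hm.isDefinedKernel T' X', hm.isRealKernel T' X', hm.hasSpacelikeSupport T' X',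
      vanishesPointwise_of_isPaleyWiener T' X' fun k =>
        exists_isPaleyWiener_modeSymbol (by linarith) hZ k⟩
  · have hm : IsAdmissibleSymbol Z' (robinSymbol ν γ Z') :=
      (isAdmissibleSymbol_modeSymbol (μ := ν) (by linarith) hZ).linear_combination
        (isAdmissibleSymbol_modeSymbol (μ := -ν) (by linarith) hZ) (Real.cos γ) (Real.sin γ)
    refine ⟨hm.isDefinedKernel T' X', hm.isRealKernel T' X', hm.hasSpacelikeSupport T' X',
      fun hν2 => vanishesPointwise_of_isPaleyWiener T' X' fun k => ?_⟩
    obtain ⟨s, hs, h⟩ := exists_isPaleyWiener_modeSymbol (μ := ν) (by linarith) hZ k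
    obtain ⟨s', hs', h'⟩ := exists_isPaleyWiener_modeSymbol (μ := -ν) (by linarith) hZ k
    refine ⟨_, (hs.const_mul (Real.cos γ)).add (hs'.const_mul (Real.sin γ)), ?_⟩
    filter_upwards [h, h'] with ω h1 h2
    rw [robinSymbol, dirichletSymbol, neumannSymbol, h1, h2]
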